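/- Let $\mathcal A$ be a finite alphabet, let $S$ be the shift $(Sx)_n=x_{n+1}$ on $\mathcal A^{\mathbb Z}$ (product topology), and let $X\subseteq\mathcal A^{\mathbb Z}$ be a non-empty subshift (a closed set with $S(X)=X$) that is minimal, i.e. the orbit $\{S^n x:n\in\mathbb Z\}$ of every $x\in X$ is dense in $X$. Let $p_X(n)$ be the number of words of length $n$ that occur in points of $X$. Definitions. An *ordered Bratteli diagram* consists of finite vertex levels $V_0,V_1,V_2,\dots$ with $|V_0|=1$, finite edge sets $E_n$ ($n\ge 1$) with source and range maps $\mathsf s\colon E_n\to V_{n-1}$ and $\mathsf r\colon E_n\to V_n$, both surjective, and a partial order on the edges for which two edges are comparable if and only if they have the same range. It is *simple* if for every $n\ge 1$ there is $N>n$ such that every vertex of $V_n$ is joined to every vertex of $V_N$ by a finite path. Its path space $X_B$ is the set of infinite paths $(x_1,x_2,\dots)$ with $x_n\in E_n$ and $\mathsf r(x_n)=\mathsf s(x_{n+1})$, with the topology generated by cylinder sets. It is *properly ordered* if there is exactly one path $x_{\max}$ all of whose edges are maximal and exactly one path $x_{\min}$ all of whose edges are minimal. The *Vershik map* $V_B\colon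 X_B\to X_B$ sends $x_{\max}$ to $x_{\min}$; for $x\ne x_{\max}$ it replaces the first non-maximal edge $x_n$ by its successor $y_n$, replaces $(x_1,\dots,x_{n-1})$ by the unique path of minimal edges from $V_0$ to $\mathsf s(y_n)$, and keeps $x_i$ for $i>n$. A *Bratteli-Vershik representation* of a system $(X,T)$ is a simple, properly ordered Bratteli diagram $B$ such that $(X_B,V_B)$ is topologically conjugate to $(X,T)$. The *topological rank* of $(X,T)$ is the least $d$ such that $(X,T)$ has a Bratteli-Vershik representation with $|V_n|\le d$ for all $n$ ($+\infty$ if there is no such $d$). **Theorem.** 1. If $X$ is infinite and $K_1=\liminf_{n\to+\infty}\bigl(p_X(n+1)-p_X(n)\bigr)$ is finite, then the topological rank of $(X,S)$ is at most $(1+|\mathcal A|^2K_1^2)^{2(K_1+2)}$. 2. In particular, if $X$ has non-superlinear complexity, i.e. $\liminf_{n\to+\infty}p_X(n)/n<+\infty$, then $(X,S)$ has finite topological rank. -/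

import Mathlib

open Filter Set

open scoped ENNReal

/-! ### Topological dynamics -/

/-- A homeomorphism is minimal if the (two-sided) orbit of every point is dense. -/
def IsMinimalHomeo {X : Type*} [TopologicalSpace X] (T : X ≃ₜ X) : Prop :=
  ∀ x : X, Dense (Set.range fun n : ℤ => (T ^ n) x)

/-! ### Subshifts -/

namespace SymbolicDynamics.FullShift.Subshift

variable {A : Type*} [TopologicalSpace A] (X : Subshift A ℤ)

/-- The shift map `(S x) n = x (n + 1)` on the points of a two-sided subshift. -/
def shiftHomeo : X.carrier ≃ₜ X.carrier where
  toFun x := ⟨fun n => x.1 (n + 1), by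
    have h := X.mapsTo 1 x.2
    have e : FullShift.shift (1 : ℤ) x.1 = fun n => x.1 (n + 1) := by
      funext n; simp [FullShift.shift, add_comm]
    rwa [e] at h⟩
  invFun x := ⟨fun n => x.1 (n - 1), by
    have h := X.mapsTo (-1) x.2
    have e : FullShift.shift (-1 : ℤ) x.1 = fun n => x.1 (n - 1) := by
      funext n; simp [FullShift.shift, sub_eq_add_neg, add_comm]
    rwa [e] at h⟩
  left_inv x := by ext n; simp
  right_inv x := by ext n; simp
  continuous_toFun := by
    refine Continuous.subtype_mk (continuous_pi fun n => ?_) _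
    exact (continuous_apply (n + 1)).comp continuous_subtype_val
  continuous_invFun := by
    refine Continuous.subtype_mk (continuous_pi fun n => ?_) _
    exact (continuous_apply (n - 1)).comp continuous_subtype_val

/-- The words of length `n` occurring in some point of the subshift. -/
def words (n : ℕ) : Set (Fin n → A) :=
  {w | ∃ x ∈ X.carrier, ∃ m : ℤ, ∀ i : Fin n, w i = x (m + (i : ℕ))}

/-- The complexity function: the number of words of length `n` in the language. -/
noncomputable def complexity (n : ℕ) : ℕ := (X.words n).ncard

/-- Over a finite alphabet the complexity function is nondecreasing, so differences
`p (n + 1) - p n` of natural numbers are never truncated. -/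
theorem complexity_mono [Finite A] (n : ℕ) : X.complexity n ≤ X.complexity (n + 1) := by
  have h : X.words n = (fun w : Fin (n + 1) → A => fun i : Fin n => w i.castSucc) ''
      X.words (n + 1) := by
    ext w
    constructor
    · rintro ⟨x, hx, m, hw⟩
      refine ⟨fun i => x (m + (i : ℕ)), ⟨x, hx, m, fun i => rfl⟩, ?_⟩
      funext i
      simp [hw i]
    · rintro ⟨v, ⟨x, hx, m, hv⟩, rfl⟩
      exact ⟨x, hx, m, fun i => by simp [hv]⟩
  unfold complexity
  rw [h]
  exact Set.ncard_image_le (Set.toFinite _)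

end SymbolicDynamics.FullShift.Subshift

/-! ### Ordered Bratteli diagrams -/

/-- An ordered Bratteli diagram. The vertices are divided into finite levels `V 0, V 1, …`, where
`V 0` has exactly one element; `E n` is the finite set of edges from `V n` to `V (n + 1)`
(numbered from `0`). Every vertex is the source of an edge, every vertex outside `V 0` is the range
of an edge, and the edges carry a partial order for which two edges are comparable if and only
if they have the same range. -/
structure OrderedBratteliDiagram where
  V : ℕ → Type
  E : ℕ → Type
  finite_V : ∀ n, Finite (V n)
  finite_E : ∀ n, Finite (E n)
  card_root : Nat.card (V 0) = 1
  src : ∀ {n}, E n → V n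
  rng : ∀ {n}, E n → V (n + 1)
  src_surjective : ∀ n, Function.Surjective (src (n := n))
  rng_surjective : ∀ n, Function.Surjective (rng (n := n))
  order : ∀ n, PartialOrder (E n)
  comparable_iff : ∀ {n} (e f : E n), (e ≤ f ∨ f ≤ e) ↔ rng e = rng f

namespace OrderedBratteliDiagram

variable (B : OrderedBratteliDiagram)

instance (n : ℕ) : PartialOrder (B.E n) := B.order n

instance (n : ℕ) : Finite (B.E n) := B.finite_E n

/-- Edge sets are finite discrete spaces. -/
instance (n : ℕ) : TopologicalSpace (B.E n) := ⊥

instance (n : ℕ) : DiscreteTopology (B.E n) := ⟨rfl⟩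

/-- `B.Reach u v`: there is a finite path from the vertex `u` down to the vertex `v`. -/
inductive Reach {n : ℕ} (u : B.V n) : {m : ℕ} → B.V m → Prop
  | refl : Reach u u
  | step {m : ℕ} (e : B.E m) : Reach u (B.src e) → Reach u (B.rng e)

/-- A Bratteli diagram is simple if for every `n ≥ 1` there is a level `N > n` such that every
vertex of level `n` is connected to every vertex of level `N` by a path. -/
def IsSimple : Prop :=
  ∀ n ≥ 1, ∃ N > n, ∀ (u : B.V n) (v : B.V N), B.Reach u v

/-- The space of infinite paths starting at the root, with the topology generated by the cylinder
sets (equivalently, induced by the product of the discrete topologies). -/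
def PathSpace : Type := {x : ∀ n, B.E n // ∀ n, B.rng (x n) = B.src (x (n + 1))}

instance : TopologicalSpace B.PathSpace :=
  inferInstanceAs (TopologicalSpace {x : ∀ n, B.E n // ∀ n, B.rng (x n) = B.src (x (n + 1))})

/-- All edges of the path are maximal (among the edges with the same range). -/
def IsMaxPath (x : B.PathSpace) : Prop := ∀ n, IsMax (x.1 n)

/-- All edges of the path are minimal (among the edges with the same range). -/
def IsMinPath (x : B.PathSpace) : Prop := ∀ n, IsMin (x.1 n)

/-- The diagram has a unique maximal path and a unique minimal path. -/
def IsProperlyOrdered : Prop := (∃! x, B.IsMaxPath x) ∧ ∃! x, B.IsMinPath x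

/-- `y` is the image of `x` under the Vershik map: either `x` is the maximal path and `y` is the
minimal one; or, `n` being the first index at which the edge of `x` is not maximal, the `n`-th edge
of `y` is the successor of that of `x`, the earlier edges of `y` are minimal and the later
edges of `x` and `y` agree. -/
def IsVershikImage (x y : B.PathSpace) : Prop :=
  (B.IsMaxPath x ∧ B.IsMinPath y) ∨
    ∃ n, (∀ i < n, IsMax (x.1 i)) ∧ ¬ IsMax (x.1 n) ∧ x.1 n ⋖ y.1 n ∧
      (∀ i < n, IsMin (y.1 i)) ∧ ∀ i > n, y.1 i = x.1 i

variable {B}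

theorem rng_eq_of_covBy {n : ℕ} {e f : B.E n} (h : e ⋖ f) : B.rng e = B.rng f :=
  (B.comparable_iff e f).1 (Or.inl h.le)

theorem eq_of_isMin {n : ℕ} {e f : B.E n} (he : IsMin e) (hf : IsMin f)
    (h : B.rng e = B.rng f) : e = f := by
  rcases (B.comparable_iff e f).2 h with h | h
  · exact le_antisymm h (hf h)
  · exact le_antisymm (he h) h

theorem eq_of_covBy {n : ℕ} {e f g : B.E n} (hf : e ⋖ f) (hg : e ⋖ g) : f = g := by
  have h : B.rng f = B.rng g := (rng_eq_of_covBy hf).symm.trans (rng_eq_of_covBy hg)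
  rcases (B.comparable_iff f g).2 h with h | h
  · rcases h.lt_or_eq with h | h
    · exact (hg.2 hf.lt h).elim
    · exact h
  · rcases h.lt_or_eq with h | h
    · exact (hf.2 hg.lt h).elim
    · exact h.symm

theorem exists_isMin_edge {n : ℕ} (v : B.V (n + 1)) : ∃ f : B.E n, B.rng f = v ∧ IsMin f := by
  obtain ⟨e, rfl⟩ := B.rng_surjective n v
  obtain ⟨f, hf, hmin⟩ := (Set.toFinite {f : B.E n | f ≤ e}).exists_minimal ⟨e, le_refl e⟩
  exact ⟨f, (B.comparable_iff f e).1 (Or.inl hf), fun g hg => hmin (hg.trans hf) hg⟩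

theorem exists_min_prefix (x : ∀ n, B.E n) : ∀ (n : ℕ) (e : B.E n), ∃ z : ∀ n, B.E n,
    z n = e ∧ (∀ i < n, IsMin (z i)) ∧ (∀ i < n, B.rng (z i) = B.src (z (i + 1))) ∧
      ∀ i > n, z i = x i := by
  intro n
  induction n with
  | zero =>
    intro e
    refine ⟨Function.update x 0 e, by simp, by simp, by simp, fun i hi => ?_⟩
    exact Function.update_of_ne (by omega) _ _
  | succ n ih =>
    intro e
    obtain ⟨f, hf, hmin⟩ := exists_isMin_edge (B.src e)
    obtain ⟨z, hz, h1, h2, h3⟩ := ih f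
    refine ⟨Function.update z (n + 1) e, by simp, ?_, ?_, ?_⟩
    · intro i hi
      rw [Function.update_of_ne (by omega)]
      rcases Nat.lt_succ_iff_lt_or_eq.1 hi with h | rfl
      · exact h1 i h
      · rwa [hz]
    · intro i hi
      rw [Function.update_of_ne (by omega : i ≠ n + 1)]
      rcases Nat.lt_succ_iff_lt_or_eq.1 hi with h | rfl
      · rw [Function.update_of_ne (by omega)]
        exact h2 i h
      · rw [Function.update_self, hz, hf]
    · intro i hi
      rw [Function.update_of_ne (by omega)]
      exact h3 i (by omega)

theorem existsUnique_vershikImage (h : B.IsProperlyOrdered) (x : B.PathSpace) :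
    ∃! y, B.IsVershikImage x y := by
  classical
  by_cases hx : B.IsMaxPath x
  · obtain ⟨y, hy, huniq⟩ := h.2
    refine ⟨y, Or.inl ⟨hx, hy⟩, ?_⟩
    rintro z (⟨-, hz⟩ | ⟨n, -, hn, -⟩)
    · exact huniq z hz
    · exact (hn (hx n)).elim
  · have hx' : ∃ n, ¬ IsMax (x.1 n) := by
      by_contra hcon
      exact hx fun n => by_contra fun hn => hcon ⟨n, hn⟩
    obtain ⟨n, hn, hlt⟩ : ∃ n, ¬ IsMax (x.1 n) ∧ ∀ i < n, IsMax (x.1 i) :=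
      ⟨Nat.find hx', Nat.find_spec hx', fun i hi => not_not.1 (Nat.find_min hx' hi)⟩
    obtain ⟨e, he⟩ : ∃ e, x.1 n ⋖ e := by
      obtain ⟨f, hf⟩ := not_isMax_iff.1 hn
      obtain ⟨e, he, hmin⟩ := (Set.toFinite {g : B.E n | x.1 n < g}).exists_minimal ⟨f, hf⟩
      exact ⟨e, he, fun g hg hge => hge.not_ge (hmin hg hge.le)⟩
    obtain ⟨z, hz, h1, h2, h3⟩ := exists_min_prefix x.1 n e
    refine ⟨⟨z, fun i => ?_⟩, Or.inr ⟨n, hlt, hn, ?_, h1, h3⟩, ?_⟩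
    · rcases lt_trichotomy i n with hi | rfl | hi
      · exact h2 i hi
      · rw [hz, h3 (i + 1) (by omega), ← x.2 i, rng_eq_of_covBy he]
      · rw [h3 i hi, h3 (i + 1) (by omega), x.2 i]
    · simpa only [hz] using he
    · rintro y (⟨hm, -⟩ | ⟨k, hk, hkn, hcov, hymin, hytail⟩)
      · exact (hx hm).elim
      · obtain rfl : k = n := by
          rcases lt_trichotomy k n with hi | hi | hi
          · exact (hkn (hlt k hi)).elim
          · exact hi
          · exact (hn (hk n hi)).elim
        have hyk : y.1 k = z k := by rw [hz]; exact eq_of_covBy hcov he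
        have key : ∀ j i, i + j = k → y.1 i = z i := by
          intro j
          induction j with
          | zero => intro i hi; obtain rfl : i = k := by omega
                    exact hyk
          | succ j ih =>
            intro i hi
            refine eq_of_isMin (hymin i (by omega)) (h1 i (by omega)) ?_
            rw [y.2 i, h2 i (by omega), ih (i + 1) (by omega)]
        refine Subtype.ext (funext fun i => ?_)
        rcases le_or_gt i k with hi | hi
        · exact key (k - i) i (by omega)
        · rw [hytail i hi]; exact (h3 i hi).symm

/-- The Vershik map of a properly ordered Bratteli diagram. -/
noncomputable def vershik (h : B.IsProperlyOrdered) (x : B.PathSpace) : B.PathSpace :=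
  (existsUnique_vershikImage h x).choose

theorem vershik_eq_iff (h : B.IsProperlyOrdered) (x y : B.PathSpace) :
    vershik h x = y ↔ B.IsVershikImage x y := by
  obtain ⟨h1, h2⟩ := (existsUnique_vershikImage h x).choose_spec
  exact ⟨fun e => e ▸ h1, fun e => (h2 y e).symm⟩

end OrderedBratteliDiagram

/-! ### Topological rank -/

/-- `B` is a Bratteli-Vershik representation of `(X, T)`: it is simple and properly ordered, and
`(X, T)` is topologically conjugate to the path space of `B` with the Vershik map. -/
def IsBratteliVershikRep {X : Type*} [TopologicalSpace X] (T : X ≃ₜ X)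
    (B : OrderedBratteliDiagram) : Prop :=
  B.IsSimple ∧ ∃ h : B.IsProperlyOrdered, ∃ φ : X ≃ₜ B.PathSpace,
    ∀ x, φ (T x) = OrderedBratteliDiagram.vershik h (φ x)

/-- The topological rank of `(X, T)`: the least `d` such that `(X, T)` has a Bratteli-Vershik
representation with at most `d` vertices on every level (`⊤` if there is none). -/
noncomputable def topologicalRank {X : Type*} [TopologicalSpace X] (T : X ≃ₜ X) : ℕ∞ :=
  ⨅ (d : ℕ) (_ : ∃ B : OrderedBratteliDiagram, IsBratteliVershikRep T B ∧
    ∀ n, Nat.card (B.V n) ≤ d), (d : ℕ∞)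

/-! The bound comes from clopen sets with few return words. A nested sequence of Kakutani–Rokhlin
partitions that separates points, whose bases shrink to one point and whose towers eventually cross
all towers of each earlier level, gives a Bratteli diagram: vertices are towers, and edges are the
visits of a tower to the preceding base, ordered by height (`isBratteliVershikRep_diagram`). Each
return word to a base gives one tower, so it suffices to find, in every cylinder, a clopen base with
a bounded number of return words.

Let u be the central word of a cylinder; its occurrences have gaps at most M. Take n large with
p(n+1) - p(n) ≤ K, so that at most K words of length n are right special (`ncard_rightSpecial_le`).
The base consists of the marks: the occurrences of u that are the last one before the end of some
right special word. A word that is not right special forces the next letter. Hence, from a mark on,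
the point is determined by the first right special word met, which is long enough to reach back over
u, and by the letters chosen after right special words. Up to the next mark these choices all take
place before another occurrence of u is completed, since otherwise there would be an earlier mark.
On so short a stretch no word of length n repeats, by aperiodicity, so one letter per right special
word records everything. This leaves at most (K+1)|A|^K return words (`exists_isClopen_code`), which
is below the bound claimed.

If p(n)/n has finite lower limit, the differences p(n+1) - p(n) are bounded along a subsequence, and
the same argument applies. Finite systems are a single tower. -/

/-! ### Kakutani–Rokhlin partitions -/

/-- A clopen Kakutani–Rokhlin partition of the system `(X, T)`: the point `x` lies at level `lvl x`
of the tower `vtx x`, and `T` moves points up in their tower until they reach the top, from where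
they return to some base. -/
structure KRPartition {X : Type*} [TopologicalSpace X] (T : X ≃ₜ X) where
  ι : Type
  finite_ι : Finite ι
  height : ι → ℕ
  vtx : X → ι
  lvl : X → ℕ
  vtx_loc : IsLocallyConstant vtx
  lvl_loc : IsLocallyConstant lvl
  lvl_lt : ∀ x, lvl x < height (vtx x)
  map_of_lt : ∀ x, lvl x + 1 < height (vtx x) → vtx (T x) = vtx x ∧ lvl (T x) = lvl x + 1
  map_of_top : ∀ x, lvl x + 1 = height (vtx x) → lvl (T x) = 0
  vtx_surjective : Function.Surjective vtx

namespace KRPartition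

variable {X : Type*} [TopologicalSpace X] {T : X ≃ₜ X} (Q P : KRPartition T)

instance : Finite P.ι := P.finite_ι

/-- `x` lies at the top of its tower. -/
def IsTop (x : X) : Prop := P.lvl x + 1 = P.height (P.vtx x)

variable {Q P}

theorem lt_of_not_isTop {x : X} (h : ¬ P.IsTop x) : P.lvl x + 1 < P.height (P.vtx x) :=
  lt_of_le_of_ne (P.lvl_lt x) h

theorem isTop_iff {x : X} : P.IsTop x ↔ P.lvl (T x) = 0 := by
  refine ⟨P.map_of_top x, fun h => ?_⟩
  by_contra hx
  have := (P.map_of_lt x (lt_of_not_isTop hx)).2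
  omega

theorem lvl_map_le (x : X) : P.lvl (T x) ≤ P.lvl x + 1 := by
  by_cases h : P.IsTop x
  · rw [isTop_iff.1 h]; omega
  · exact (P.map_of_lt x (lt_of_not_isTop h)).2.le

theorem lvl_iterate_le (x : X) (k : ℕ) : P.lvl (T^[k] x) ≤ P.lvl x + k := by
  induction k with
  | zero => simp
  | succ k ih =>
    rw [Function.iterate_succ_apply']
    have := P.lvl_map_le (T^[k] x)
    omega

theorem symm_of_pos {x : X} (h : 0 < P.lvl x) :
    P.vtx (T.symm x) = P.vtx x ∧ P.lvl (T.symm x) = P.lvl x - 1 := by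
  have hx : ¬ P.IsTop (T.symm x) := by
    rw [isTop_iff, T.apply_symm_apply]; omega
  have := P.map_of_lt _ (lt_of_not_isTop hx)
  rw [T.apply_symm_apply] at this
  exact ⟨this.1.symm, by omega⟩

theorem symm_iterate {x : X} {k : ℕ} (h : k ≤ P.lvl x) :
    P.vtx (T.symm^[k] x) = P.vtx x ∧ P.lvl (T.symm^[k] x) = P.lvl x - k := by
  induction k with
  | zero => simp
  | succ k ih =>
    obtain ⟨h1, h2⟩ := ih (by omega)
    rw [Function.iterate_succ_apply']
    have := symm_of_pos (P := P) (x := T.symm^[k] x) (by omega)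
    exact ⟨this.1.trans h1, by omega⟩

theorem iterate_symm_iterate (x : X) (k : ℕ) : T^[k] (T.symm^[k] x) = x :=
  (Function.LeftInverse.iterate T.apply_symm_apply k) x

theorem iterate_of_lt {x : X} {k : ℕ} (h : P.lvl x + k < P.height (P.vtx x)) :
    P.vtx (T^[k] x) = P.vtx x ∧ P.lvl (T^[k] x) = P.lvl x + k := by
  induction k with
  | zero => simp
  | succ k ih =>
    obtain ⟨h1, h2⟩ := ih (by omega)
    rw [Function.iterate_succ_apply']
    have := P.map_of_lt (T^[k] x) (by rw [h1]; omega)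
    exact ⟨this.1.trans h1, by omega⟩

theorem exists_base (v : P.ι) : ∃ x, P.vtx x = v ∧ P.lvl x = 0 := by
  obtain ⟨x, rfl⟩ := P.vtx_surjective v
  exact ⟨T.symm^[P.lvl x] x, (symm_iterate le_rfl).1, by rw [(symm_iterate le_rfl).2]; omega⟩

variable (Q P) in
/-- `Q` refines `P`, as a partition, and the base of `Q` is contained in the base of `P`. -/
structure Refines : Prop where
  eq : ∀ x y, Q.vtx x = Q.vtx y → Q.lvl x = Q.lvl y → P.vtx x = P.vtx y ∧ P.lvl x = P.lvl y
  base : ∀ x, Q.lvl x = 0 → P.lvl x = 0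

/-! ### Levels in a partition and in its refinement -/

namespace Refines

variable (h : Q.Refines P)

include h

/-- Going down to the base of `Q` reaches the base of `P`, and the level in `P` rises by at most one
per step on the way back. -/
theorem lvl_le (x : X) : P.lvl x ≤ Q.lvl x := by
  have h1 := h.base (T.symm^[Q.lvl x] x) (by rw [(symm_iterate le_rfl).2]; omega)
  have h2 := P.lvl_iterate_le (T.symm^[Q.lvl x] x) (Q.lvl x)
  rw [iterate_symm_iterate] at h2
  omega

theorem isTop {x : X} (hx : Q.IsTop x) : P.IsTop x :=
  isTop_iff.2 (h.base _ (isTop_iff.1 hx))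

theorem iterate_of_lt {x : X} {k : ℕ} (hk : P.lvl x + k < P.height (P.vtx x)) :
    Q.vtx (T^[k] x) = Q.vtx x ∧ Q.lvl (T^[k] x) = Q.lvl x + k := by
  induction k with
  | zero => simp
  | succ k ih =>
    obtain ⟨h1, h2⟩ := ih (by omega)
    obtain ⟨h3, h4⟩ := KRPartition.iterate_of_lt (P := P) (x := x) (k := k) (by omega)
    rw [Function.iterate_succ_apply']
    have hn : ¬ Q.IsTop (T^[k] x) := fun hq => by
      have := h.isTop hq
      rw [IsTop, h3] at this
      omega
    have := Q.map_of_lt _ (lt_of_not_isTop hn)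
    exact ⟨this.1.trans h1, by omega⟩

/-- There is no visit to the base of `P` strictly between the last one before `x` and `x`. -/
theorem lvl_eq_of_base {x y : X} (hv : Q.vtx y = Q.vtx x) (hy : P.lvl y = 0)
    (h1 : Q.lvl x - P.lvl x ≤ Q.lvl y) (h2 : Q.lvl y ≤ Q.lvl x) :
    Q.lvl y = Q.lvl x - P.lvl x := by
  have hle := h.lvl_le x
  -- Descending from `x` to the level of `y` lands in the atom of `Q` containing `y`, hence at level
  -- 0 of `P`; the `P`-level of `x` is thus exactly the number of steps descended.
  have h3 := symm_iterate (P := Q) (x := x) (k := Q.lvl x - Q.lvl y) (by omega)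
  have h4 := symm_iterate (P := P) (x := x) (k := Q.lvl x - Q.lvl y) (by omega)
  have h5 := (h.eq _ y (h3.1.trans hv.symm) (by omega)).2
  omega

theorem symm_iterate_base (x : X) :
    (Q.vtx (T.symm^[P.lvl x] x) = Q.vtx x ∧
      Q.lvl (T.symm^[P.lvl x] x) = Q.lvl x - P.lvl x) ∧
    P.vtx (T.symm^[P.lvl x] x) = P.vtx x ∧ P.lvl (T.symm^[P.lvl x] x) = 0 :=
  ⟨symm_iterate (h.lvl_le x), (symm_iterate le_rfl).1, by rw [(symm_iterate le_rfl).2]; omega⟩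

end Refines

variable (Q P) in
/-- The visits of the towers of `Q` to the base of `P`, as pairs (tower of `Q`, level). -/
def Edge : Type :=
  {e : Q.ι × ℕ // ∃ x, Q.vtx x = e.1 ∧ Q.lvl x = e.2 ∧ P.lvl x = 0}

/-! ### Visits to the smaller tower bases, ordered by height -/

namespace Edge

instance : Finite (Edge Q P) := by
  have : ∀ e : Edge Q P, e.1.2 < Q.height e.1.1 := by
    intro e
    obtain ⟨x, hv, hl, -⟩ := e.2
    rw [← hv, ← hl]
    exact Q.lvl_lt x
  refine Finite.of_injective (β := Σ v : Q.ι, Fin (Q.height v))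
    (fun e => ⟨e.1.1, ⟨e.1.2, this e⟩⟩) ?_
  rintro ⟨⟨v, j⟩, hv⟩ ⟨⟨w, k⟩, hw⟩ h
  simp only [Sigma.mk.injEq] at h
  obtain ⟨rfl, h⟩ := h
  simp only [heq_eq_eq, Fin.mk.injEq] at h
  subst h
  rfl

instance : PartialOrder (Edge Q P) where
  le e f := e.1.1 = f.1.1 ∧ e.1.2 ≤ f.1.2
  le_refl e := ⟨rfl, le_rfl⟩
  le_trans e f g h1 h2 := ⟨h1.1.trans h2.1, h1.2.trans h2.2⟩
  le_antisymm e f h1 h2 := Subtype.ext (Prod.ext h1.1 (le_antisymm h1.2 h2.2))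

theorem le_iff {e f : Edge Q P} : e ≤ f ↔ e.1.1 = f.1.1 ∧ e.1.2 ≤ f.1.2 := Iff.rfl

theorem lt_iff {e f : Edge Q P} : e < f ↔ e.1.1 = f.1.1 ∧ e.1.2 < f.1.2 := by
  rw [lt_iff_le_not_ge, le_iff, le_iff]
  constructor
  · rintro ⟨⟨h1, h2⟩, h3⟩
    exact ⟨h1, lt_of_not_ge fun h => h3 ⟨h1.symm, h⟩⟩
  · rintro ⟨h1, h2⟩
    exact ⟨⟨h1, h2.le⟩, fun h => absurd h.2 (not_le.2 h2)⟩

/-- The tower of `P` based at the given visit. -/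
noncomputable def source (e : Edge Q P) : P.ι := P.vtx e.2.choose

/-- The visit to the base of `P` from which `x` is reached inside its tower of `P`. -/
def of (h : Q.Refines P) (x : X) : Edge Q P :=
  ⟨(Q.vtx x, Q.lvl x - P.lvl x), T.symm^[P.lvl x] x, (h.symm_iterate_base x).1.1,
    (h.symm_iterate_base x).1.2, (h.symm_iterate_base x).2.2⟩

variable (h : Q.Refines P)

theorem of_eq {x : X} (e : Edge Q P) (hv : Q.vtx x = e.1.1) (hl : Q.lvl x = e.1.2 + P.lvl x) :
    of h x = e :=
  Subtype.ext (Prod.ext hv (by simp [of, hl]))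

include h

theorem source_eq {x : X} (e : Edge Q P) (hv : Q.vtx x = e.1.1) (hl : Q.lvl x = e.1.2) :
    e.source = P.vtx x := by
  obtain ⟨h1, h2, -⟩ := e.2.choose_spec
  exact (h.eq _ _ (h1.trans hv.symm) (h2.trans hl.symm)).1

theorem source_surjective : Function.Surjective (source : Edge Q P → P.ι) := by
  intro v
  obtain ⟨x, rfl, hx⟩ := P.exists_base v
  exact ⟨⟨(Q.vtx x, Q.lvl x), x, rfl, rfl, hx⟩, source_eq h _ rfl rfl⟩

theorem range_surjective (v : Q.ι) : ∃ e : Edge Q P, e.1.1 = v := by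
  obtain ⟨x, rfl⟩ := Q.vtx_surjective v
  exact ⟨of h x, rfl⟩

theorem lvl_eq_zero_of_isMin {e : Edge Q P} (he : IsMin e) : e.1.2 = 0 := by
  obtain ⟨x, hx, hx0⟩ := Q.exists_base e.1.1
  let f : Edge Q P := ⟨(e.1.1, 0), x, hx, hx0, h.base x hx0⟩
  have hf : f ≤ e := ⟨rfl, Nat.zero_le _⟩
  exact Nat.le_zero.1 (he hf).2

omit h in
theorem isMin_of_lvl_eq_zero {e : Edge Q P} (he : e.1.2 = 0) : IsMin e :=
  fun f hf => ⟨hf.1.symm, by rw [he]; exact Nat.zero_le _⟩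

theorem source_of (x : X) : (of h x).source = P.vtx x := by
  obtain ⟨h1, h2, -⟩ := h.symm_iterate_base x
  rw [source_eq h (x := T.symm^[P.lvl x] x) (of h x) h1.1 h1.2, h2]

theorem isMax_of {x : X} (hx : Q.IsTop x) : IsMax (of h x) := by
  intro f hle
  obtain ⟨y, hv, hl, hy⟩ := f.2
  have hlt := Q.lvl_lt y
  have h1 : Q.vtx y = Q.vtx x := hv.trans hle.1.symm
  rw [h1, ← hx] at hlt
  refine ⟨hle.1.symm, ?_⟩
  rw [← hl]
  exact (h.lvl_eq_of_base h1 hy (hle.2.trans hl.ge) (by omega)).le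

theorem isLocallyConstant_of : IsLocallyConstant (of h) := by
  rw [IsLocallyConstant.iff_eventually_eq]
  intro x
  filter_upwards [Q.vtx_loc.eventually_eq x, Q.lvl_loc.eventually_eq x,
    P.lvl_loc.eventually_eq x] with y h1 h2 h3
  exact Subtype.ext (Prod.ext h1 (by simp [of, h2, h3]))

/-- Leaving the top of a `P`-tower inside a `Q`-tower starts the next visit; an intermediate visit
would contradict `lvl_eq_of_base`. -/
theorem covBy_of {x : X} (hP : P.IsTop x) (hQ : ¬ Q.IsTop x) : of h x ⋖ of h (T x) := by
  obtain ⟨h1, h2⟩ := Q.map_of_lt x (lt_of_not_isTop hQ)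
  have h3 := isTop_iff.1 hP
  constructor
  · rw [lt_iff]
    refine ⟨h1.symm, ?_⟩
    change Q.lvl x - P.lvl x < Q.lvl (T x) - P.lvl (T x)
    omega
  · intro f hlt hlt'
    obtain ⟨y, hv, hl, hy⟩ := f.2
    rw [lt_iff, ← hv, ← hl] at hlt hlt'
    have h4 : Q.vtx y = Q.vtx x := hlt.1.symm
    have h5 : Q.lvl x - P.lvl x < Q.lvl y := hlt.2
    have h6 : Q.lvl y < Q.lvl (T x) - P.lvl (T x) := hlt'.2
    have := h.lvl_eq_of_base h4 hy h5.le (by omega)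
    omega

end Edge

/-! ### The Bratteli diagram of a nested sequence of partitions -/

section Diagram

variable (P : ℕ → KRPartition T) (hP : ∀ n, (P (n + 1)).Refines (P n))
  (h0 : Nat.card (P 0).ι = 1)

/-- The ordered Bratteli diagram of a nested sequence of Kakutani–Rokhlin partitions. -/
noncomputable def diagram : OrderedBratteliDiagram where
  V n := (P n).ι
  E n := Edge (P (n + 1)) (P n)
  finite_V n := (P n).finite_ι
  finite_E n := inferInstance
  card_root := h0
  src e := e.source
  rng e := e.1.1
  src_surjective n := Edge.source_surjective (hP n)
  rng_surjective n := Edge.range_surjective (hP n)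
  order n := inferInstance
  comparable_iff e f := by
    constructor
    · rintro (h | h)
      exacts [h.1, h.1.symm]
    · intro h
      rcases le_total e.1.2 f.1.2 with h' | h'
      exacts [Or.inl ⟨h, h'⟩, Or.inr ⟨h.symm, h'⟩]

/-- The path of a point in the diagram of a nested sequence of partitions. -/
noncomputable def toPath (x : X) : (diagram P hP h0).PathSpace :=
  ⟨fun n => Edge.of (hP n) x, fun n => (Edge.source_of (hP (n + 1)) x).symm⟩

theorem continuous_toPath : Continuous (toPath P hP h0) := by
  refine Continuous.subtype_mk (continuous_pi fun n => ?_) _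
  exact IsLocallyConstant.continuous (Y := (diagram P hP h0).E n)
    (Edge.isLocallyConstant_of (hP n))

variable {P}

include hP in
theorem eq_of_eq_of_le {m n : ℕ} (hmn : m ≤ n) {x y : X} (h1 : (P n).vtx x = (P n).vtx y)
    (h2 : (P n).lvl x = (P n).lvl y) : (P m).vtx x = (P m).vtx y ∧ (P m).lvl x = (P m).lvl y := by
  induction hmn with
  | refl => exact ⟨h1, h2⟩
  | step _ ih =>
    obtain ⟨h3, h4⟩ := (hP _).eq x y h1 h2
    exact ih h3 h4

include hP in
theorem isTop_of_le {m n : ℕ} (hmn : m ≤ n) {x : X} (h : (P n).IsTop x) : (P m).IsTop x := by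
  induction hmn with
  | refl => exact h
  | step _ ih => exact ih ((hP _).isTop h)

include h0 in
theorem root_eq (u v : (P 0).ι) : u = v :=
  have := (Nat.card_eq_one_iff_unique.1 h0).1
  Subsingleton.elim u v

/-- Every finite path is realised. A point `x` following the first `N` edges lies in the `P N`-tower
where the next visit starts; climbing from that visit to the level of `x` gives a point in the same
atom of `P N`, which therefore keeps the earlier edges and has the required new one. -/
theorem exists_toPath_eq [Nonempty X] (e : (diagram P hP h0).PathSpace) (N : ℕ) :
    ∃ x, (∀ k < N, (toPath P hP h0 x).1 k = e.1 k) ∧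
      (P N).vtx x = Edge.source (e.1 N : Edge (P (N + 1)) (P N)) := by
  induction N with
  | zero =>
    inhabit X
    exact ⟨default, by simp, root_eq h0 _ _⟩
  | succ N ih =>
    obtain ⟨x, hx, hxN⟩ := ih
    set f : Edge (P (N + 1)) (P N) := e.1 N with hf
    obtain ⟨y, hy1, hy2, hy3⟩ := f.2
    rw [Edge.source_eq (hP N) f hy1 hy2] at hxN
    have hlt : (P N).lvl y + (P N).lvl x < (P N).height ((P N).vtx y) := by
      rw [hy3, zero_add, ← hxN]; exact (P N).lvl_lt x
    obtain ⟨h1, h2⟩ := iterate_of_lt hlt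
    obtain ⟨h3, h4⟩ := (hP N).iterate_of_lt hlt
    have h1' := h1.trans hxN.symm
    have h2' : (P N).lvl (T^[(P N).lvl x] y) = (P N).lvl x := by omega
    refine ⟨T^[(P N).lvl x] y, fun k hk => ?_, ?_⟩
    · rcases Nat.lt_succ_iff_lt_or_eq.1 hk with hk | rfl
      · rw [← hx k hk]
        obtain ⟨h5, h6⟩ := eq_of_eq_of_le hP (Nat.succ_le_of_lt hk) h1' h2'
        obtain ⟨-, h7⟩ := eq_of_eq_of_le hP hk.le h1' h2'
        exact Subtype.ext (Prod.ext h5 (congrArg₂ (· - ·) h6 h7))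
      · exact Edge.of_eq (hP k) f (h3.trans hy1) (by omega)
    · rw [h3, hy1]
      exact e.2 N

theorem toPath_surjective [CompactSpace X] [Nonempty X] :
    Function.Surjective (toPath P hP h0) := by
  intro e
  have hC : ∀ N, IsClosed {x | ∀ k < N, (toPath P hP h0 x).1 k = e.1 k} := by
    intro N
    simp only [ofPred_forall]
    refine isClosed_iInter fun k => isClosed_iInter fun _ => ?_
    have hc : Continuous fun x => (toPath P hP h0 x).1 k :=
      (continuous_apply k).comp (continuous_subtype_val.comp (continuous_toPath P hP h0))
    exact (isClosed_discrete {e.1 k}).preimage hc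
  obtain ⟨x, hx⟩ := IsCompact.nonempty_iInter_of_sequence_nonempty_isCompact_isClosed
    (fun N => {x | ∀ k < N, (toPath P hP h0 x).1 k = e.1 k})
    (fun N x hx k hk => hx k (by omega))
    (fun N => (exists_toPath_eq hP h0 e N).imp fun x hx => hx.1) (hC 0).isCompact hC
  refine ⟨x, Subtype.ext (funext fun k => ?_)⟩
  exact mem_iInter.1 hx (k + 1) k (by omega)

variable (h0' : ∀ x, (P 0).lvl x = 0)

-- An edge gives the difference of two consecutive levels; summing from level 0 recovers the level
-- of the point in every partition.
include h0' in
theorem toPath_injective (hsep : ∀ x y, (∀ n, (P n).vtx x = (P n).vtx y ∧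
    (P n).lvl x = (P n).lvl y) → x = y) : Function.Injective (toPath P hP h0) := by
  intro x y hxy
  refine hsep x y fun n => ?_
  induction n with
  | zero => exact ⟨root_eq h0 _ _, by rw [h0', h0']⟩
  | succ n ih =>
    have h1 : Edge.of (hP n) x = Edge.of (hP n) y := congrFun (congrArg Subtype.val hxy) n
    have h2 := congrArg (fun e => e.1.1) h1
    have h3 : (P (n + 1)).lvl x - (P n).lvl x = (P (n + 1)).lvl y - (P n).lvl y :=
      congrArg (fun e => e.1.2) h1
    have h4 := (hP n).lvl_le x
    have h5 := (hP n).lvl_le y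
    exact ⟨h2, by omega⟩

include h0' in
theorem isTop_of_isMaxPath (hh : ∀ v, (P 0).height v = 1) {x : X}
    (hx : (diagram P hP h0).IsMaxPath (toPath P hP h0 x)) (n : ℕ) : (P n).IsTop x := by
  induction n with
  | zero => rw [IsTop, h0', hh]
  | succ n ih =>
    by_contra hn
    have h1 := (Edge.covBy_of (hP n) ih hn).lt
    have h2 : IsMax (Edge.of (hP n) x) := hx n
    exact h2.not_lt h1

theorem isMaxPath_of_isTop {x : X} (hx : ∀ n, (P n).IsTop x) :
    (diagram P hP h0).IsMaxPath (toPath P hP h0 x) :=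
  fun n => Edge.isMax_of (hP n) (hx (n + 1))

include h0' in
theorem lvl_eq_zero_of_isMinPath {x : X}
    (hx : (diagram P hP h0).IsMinPath (toPath P hP h0 x)) (n : ℕ) : (P n).lvl x = 0 := by
  induction n with
  | zero => exact h0' x
  | succ n ih =>
    have h1 : (P (n + 1)).lvl x - (P n).lvl x = 0 := Edge.lvl_eq_zero_of_isMin (hP n) (hx n)
    omega

theorem isMin_toPath {x : X} {n : ℕ} (hx : (P (n + 1)).lvl x = 0) :
    IsMin ((toPath P hP h0 x).1 n) := by
  refine Edge.isMin_of_lvl_eq_zero ?_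
  change (P (n + 1)).lvl x - (P n).lvl x = 0
  omega

theorem isProperlyOrdered_diagram [CompactSpace X] [Nonempty X] (hh : ∀ v, (P 0).height v = 1)
    (h0' : ∀ x, (P 0).lvl x = 0) (hbase : ∃! x, ∀ n, (P n).lvl x = 0) :
    (diagram P hP h0).IsProperlyOrdered := by
  obtain ⟨z, hz, hzu⟩ := hbase
  -- Being at the top of every tower means that the image under `T` is in every base, so the maximal
  -- path is that of the preimage of the common base point.
  refine ⟨⟨toPath P hP h0 (T.symm z), ?_, ?_⟩, ⟨toPath P hP h0 z, ?_, ?_⟩⟩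
  · exact isMaxPath_of_isTop hP h0 fun n => isTop_iff.2 (by rw [T.apply_symm_apply, hz n])
  · intro e he
    obtain ⟨x, rfl⟩ := toPath_surjective hP h0 e
    have := hzu (T x) fun n => isTop_iff.1 (isTop_of_isMaxPath hP h0 h0' hh he n)
    rw [← this, T.symm_apply_apply]
  · exact fun n => isMin_toPath hP h0 (hz _)
  · intro e he
    obtain ⟨x, rfl⟩ := toPath_surjective hP h0 e
    rw [hzu x fun n => lvl_eq_zero_of_isMinPath hP h0 h0' he n]

theorem isVershikImage_toPath (hh : ∀ v, (P 0).height v = 1) (h0' : ∀ x, (P 0).lvl x = 0) (x : X) :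
    (diagram P hP h0).IsVershikImage (toPath P hP h0 x) (toPath P hP h0 (T x)) := by
  classical
  by_cases hx : ∀ n, (P n).IsTop x
  · exact Or.inl ⟨isMaxPath_of_isTop hP h0 hx,
      fun n => isMin_toPath hP h0 (isTop_iff.1 (hx (n + 1)))⟩
  · push Not at hx
    obtain ⟨m, hm, hlt⟩ : ∃ m, ¬ (P m).IsTop x ∧ ∀ i < m, (P i).IsTop x :=
      ⟨Nat.find hx, Nat.find_spec hx, fun i hi => not_not.1 (Nat.find_min hx hi)⟩
    -- Everything is at the top of the root tower, of height one. The edge `n` joins levels `n` and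
    -- `n + 1`, so the first non-maximal edge has index `m - 1`.
    obtain ⟨n, rfl⟩ : ∃ n, m = n + 1 := by
      refine Nat.exists_eq_succ_of_ne_zero ?_
      rintro rfl
      exact hm (by rw [IsTop, h0', hh])
    have hcov := Edge.covBy_of (hP n) (hlt n (by omega)) hm
    refine Or.inr ⟨n, fun i hi => Edge.isMax_of (hP i) (hlt (i + 1) (by omega)), ?_, hcov,
      fun i hi => isMin_toPath hP h0 (isTop_iff.1 (hlt (i + 1) (by omega))), fun i hi => ?_⟩
    · exact fun hmax : IsMax (Edge.of (hP n) x) => hmax.not_lt hcov.lt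
    · have h1 := (P i).map_of_lt x
        (lt_of_not_isTop fun h => hm (isTop_of_le hP (by omega : n + 1 ≤ i) h))
      have h2 := (P (i + 1)).map_of_lt x
        (lt_of_not_isTop fun h => hm (isTop_of_le hP (by omega : n + 1 ≤ i + 1) h))
      refine Subtype.ext (Prod.ext h2.1 ?_)
      change (P (i + 1)).lvl (T x) - (P i).lvl (T x) = (P (i + 1)).lvl x - (P i).lvl x
      omega

theorem reach_diagram (x : X) {m n : ℕ} (hmn : m ≤ n) :
    (diagram P hP h0).Reach (n := m) ((P m).vtx x) (m := n) ((P n).vtx x) := by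
  induction hmn with
  | refl => exact OrderedBratteliDiagram.Reach.refl
  | @step k _ ih =>
    have h1 := Edge.source_of (hP k) x
    rw [← h1] at ih
    exact OrderedBratteliDiagram.Reach.step (B := diagram P hP h0) (Edge.of (hP k) x) ih

/-- A nested sequence of Kakutani–Rokhlin partitions that separates points, whose bases shrink to
a point and whose towers meet each other gives a Bratteli–Vershik representation. -/
theorem isBratteliVershikRep_diagram [CompactSpace X] [Nonempty X]
    (hh : ∀ v, (P 0).height v = 1)
    (hsep : ∀ x y, (∀ n, (P n).vtx x = (P n).vtx y ∧ (P n).lvl x = (P n).lvl y) → x = y)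
    (hbase : ∃! x, ∀ n, (P n).lvl x = 0)
    (hmeet : ∀ n ≥ 1, ∃ N > n, ∀ u v, ∃ x, (P n).vtx x = u ∧ (P N).vtx x = v) :
    IsBratteliVershikRep T (diagram P hP h0) := by
  have h0' : ∀ x, (P 0).lvl x = 0 := fun x => by
    have := (P 0).lvl_lt x
    rw [hh] at this
    omega
  have hord := isProperlyOrdered_diagram hP h0 hh h0' hbase
  refine ⟨fun n hn => ?_, hord, ?_⟩
  · obtain ⟨N, hN, H⟩ := hmeet n hn
    refine ⟨N, hN, fun u v => ?_⟩
    obtain ⟨x, rfl, rfl⟩ := H u v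
    exact reach_diagram hP h0 x hN.le
  · have : T2Space (diagram P hP h0).PathSpace :=
      inferInstanceAs (T2Space {x : ∀ n, (diagram P hP h0).E n // _})
    let φ : X ≃ (diagram P hP h0).PathSpace := Equiv.ofBijective (toPath P hP h0)
      ⟨toPath_injective hP h0 h0' hsep, toPath_surjective hP h0⟩
    refine ⟨Continuous.homeoOfEquivCompactToT2 (f := φ) (continuous_toPath P hP h0),
      fun x => Eq.symm ?_⟩
    exact (OrderedBratteliDiagram.vershik_eq_iff hord _ _).2 (isVershikImage_toPath hP h0 hh h0' x)

end Diagram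

end KRPartition

/-! ### Minimal homeomorphisms of compact spaces -/

section Minimal

variable {X : Type*} [TopologicalSpace X] {T : X ≃ₜ X}

theorem Homeomorph.zpow_natCast_apply (T : X ≃ₜ X) (k : ℕ) (x : X) :
    (T ^ (k : ℤ)) x = T^[k] x := by
  induction k with
  | zero => simp
  | succ k ih =>
    rw [Function.iterate_succ_apply', ← ih, Nat.cast_succ, add_comm, zpow_add, zpow_one,
      Homeomorph.mul_apply]

theorem Homeomorph.zpow_neg_natCast_apply (T : X ≃ₜ X) (k : ℕ) (x : X) :
    (T ^ (-(k : ℤ))) x = T.symm^[k] x := by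
  rw [← inv_zpow', Homeomorph.zpow_natCast_apply]
  rfl

theorem IsMinimalHomeo.exists_zpow_mem [CompactSpace X] (hT : IsMinimalHomeo T) {O : Set X}
    (hO : IsOpen O) (hne : O.Nonempty) : ∃ M : ℕ, ∀ x, ∃ k : ℤ, 0 < k ∧ k ≤ M ∧ (T ^ k) x ∈ O := by
  obtain ⟨F, hF⟩ := (isCompact_univ (X := X)).elim_finite_subcover (fun k : ℤ => (T ^ k) ⁻¹' O)
    (fun k => hO.preimage (T ^ k).continuous) (fun x _ => by
      obtain ⟨_, hy, k, rfl⟩ := (hT x).inter_open_nonempty O hO hne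
      exact mem_iUnion.2 ⟨k, hy⟩)
  obtain ⟨M, hM⟩ : ∃ M : ℕ, ∀ k ∈ F, k.natAbs ≤ M :=
    ⟨F.sup Int.natAbs, fun k hk => Finset.le_sup (f := Int.natAbs) hk⟩
  -- The covering times lie in `[-M, M]`; starting from `T ^ (M + 1) x` makes them positive.
  refine ⟨2 * M + 1, fun x => ?_⟩
  obtain ⟨k, hk, hkO⟩ := mem_iUnion₂.1 (hF (mem_univ ((T ^ (M + 1 : ℤ)) x)))
  have := hM k hk
  refine ⟨k + (M + 1), by omega, by push_cast; omega, ?_⟩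
  rwa [zpow_add, Homeomorph.mul_apply]

theorem IsMinimalHomeo.exists_iterate_mem [CompactSpace X] (hT : IsMinimalHomeo T) {O : Set X}
    (hO : IsOpen O) (hne : O.Nonempty) : ∃ M : ℕ, ∀ x, ∃ k : ℕ, 0 < k ∧ k ≤ M ∧ T^[k] x ∈ O := by
  obtain ⟨M, hM⟩ := hT.exists_zpow_mem hO hne
  refine ⟨M, fun x => ?_⟩
  obtain ⟨k, h0, hk, hO⟩ := hM x
  lift k to ℕ using h0.le
  rw [Homeomorph.zpow_natCast_apply] at hO
  exact ⟨k, by exact_mod_cast h0, by exact_mod_cast hk, hO⟩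

theorem IsMinimalHomeo.exists_symm_iterate_mem [CompactSpace X] (hT : IsMinimalHomeo T) {O : Set X}
    (hO : IsOpen O) (hne : O.Nonempty) (x : X) : ∃ k : ℕ, T.symm^[k] x ∈ O := by
  obtain ⟨M, hM⟩ := hT.exists_zpow_mem hO hne
  obtain ⟨k, h0, hk, hkO⟩ := hM ((T ^ (-M : ℤ)) x)
  refine ⟨(M - k).toNat, ?_⟩
  rw [← Homeomorph.zpow_neg_natCast_apply, Int.toNat_of_nonneg (by omega)]
  rw [← Homeomorph.mul_apply, ← zpow_add] at hkO
  convert hkO using 3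
  omega

/-- `r` is the time of the first return of `x` to `B`. -/
def IsReturnTime (T : X ≃ₜ X) (B : Set X) (x : X) (r : ℕ) : Prop :=
  0 < r ∧ T^[r] x ∈ B ∧ ∀ j, 0 < j → j < r → T^[j] x ∉ B

theorem IsReturnTime.eq {B : Set X} {x : X} {r s : ℕ} (hr : IsReturnTime T B x r)
    (hs : IsReturnTime T B x s) : r = s := by
  rcases lt_trichotomy r s with h | h | h
  · exact absurd hr.2.1 (hs.2.2 r hr.1 h)
  · exact h
  · exact absurd hs.2.1 (hr.2.2 s hs.1 h)

theorem IsMinimalHomeo.exists_isReturnTime [CompactSpace X] (hT : IsMinimalHomeo T) {B : Set X}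
    (hB : IsOpen B) (hne : B.Nonempty) (x : X) : ∃ r, IsReturnTime T B x r := by
  classical
  obtain ⟨M, hM⟩ := hT.exists_iterate_mem hB hne
  have h : ∃ k, 0 < k ∧ T^[k] x ∈ B := (hM x).imp fun k hk => ⟨hk.1, hk.2.2⟩
  exact ⟨Nat.find h, (Nat.find_spec h).1, (Nat.find_spec h).2,
    fun j h0 hj hjB => Nat.find_min h hj ⟨h0, hjB⟩⟩

theorem IsReturnTime.eventually {B : Set X} (hB : IsClopen B) {x : X} {r : ℕ}
    (h : IsReturnTime T B x r) : ∀ᶠ y in nhds x, IsReturnTime T B y r := by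
  have hc : ∀ j, Continuous T^[j] := fun j => T.continuous.iterate j
  have h1 : ∀ᶠ y in nhds x, T^[r] y ∈ B :=
    (hc r).continuousAt.eventually (hB.isOpen.mem_nhds h.2.1)
  have h2 : ∀ᶠ y in nhds x, ∀ j ∈ Finset.Ioo 0 r, T^[j] y ∈ Bᶜ := by
    rw [Filter.eventually_all_finset]
    intro j hj
    rw [Finset.mem_Ioo] at hj
    exact (hc j).continuousAt.eventually (hB.compl.isOpen.mem_nhds (h.2.2 j hj.1 hj.2))
  filter_upwards [h1, h2] with y hy1 hy2
  exact ⟨h.1, hy1, fun j h0 hj => hy2 j (Finset.mem_Ioo.2 ⟨h0, hj⟩)⟩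

namespace KRPartition

/-- The partition with a single tower of height one. -/
def trivial (T : X ≃ₜ X) [Nonempty X] : KRPartition T where
  ι := Unit
  finite_ι := inferInstance
  height _ := 1
  vtx _ := ()
  lvl _ := 0
  vtx_loc := IsLocallyConstant.const _
  lvl_loc := IsLocallyConstant.const _
  lvl_lt _ := one_pos
  map_of_lt _ h := absurd h (lt_irrefl _)
  map_of_top _ _ := rfl
  vtx_surjective _ := ⟨Classical.arbitrary X, rfl⟩

/-! ### Towers over a clopen base -/

section OfBase

variable {B : Set X} (hB : IsClopen B) (hvisit : ∀ x, ∃ k : ℕ, T.symm^[k] x ∈ B)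

open Classical in
/-- The time elapsed since the last visit to `B`. -/
noncomputable def age (x : X) : ℕ := Nat.find (hvisit x)

/-- The last visit to `B`. -/
noncomputable def lastVisit (x : X) : X := T.symm^[age hvisit x] x

theorem lastVisit_mem (x : X) : lastVisit hvisit x ∈ B := by
  classical exact Nat.find_spec (hvisit x)

theorem notMem_of_lt_age {x : X} {k : ℕ} (h : k < age hvisit x) : T.symm^[k] x ∉ B := by
  classical exact Nat.find_min (hvisit x) h

theorem age_eq_iff {x : X} {k : ℕ} :
    age hvisit x = k ↔ T.symm^[k] x ∈ B ∧ ∀ j < k, T.symm^[j] x ∉ B := by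
  classical exact Nat.find_eq_iff (hvisit x)

theorem age_of_mem {x : X} (h : x ∈ B) : age hvisit x = 0 :=
  (age_eq_iff hvisit).2 ⟨h, by simp⟩

theorem age_eq_zero_iff {x : X} : age hvisit x = 0 ↔ x ∈ B := by
  rw [age_eq_iff]
  simp

theorem age_map_of_notMem {x : X} (h : T x ∉ B) : age hvisit (T x) = age hvisit x + 1 := by
  rw [age_eq_iff]
  refine ⟨by simpa [lastVisit] using lastVisit_mem hvisit x, fun j hj => ?_⟩
  cases j with
  | zero => exact h
  | succ j => simpa using notMem_of_lt_age hvisit (Nat.lt_of_succ_lt_succ hj)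

theorem lastVisit_map_of_notMem {x : X} (h : T x ∉ B) :
    lastVisit hvisit (T x) = lastVisit hvisit x := by
  rw [lastVisit, age_map_of_notMem hvisit h]
  simp [lastVisit]

theorem iterate_age_lastVisit (x : X) : T^[age hvisit x] (lastVisit hvisit x) = x :=
  iterate_symm_iterate x _

theorem iterate_succ_age_lastVisit (x : X) :
    T^[age hvisit x + 1] (lastVisit hvisit x) = T x := by
  rw [Function.iterate_succ_apply', iterate_age_lastVisit]

include hB in
theorem isLocallyConstant_age : IsLocallyConstant (age hvisit) := by
  rw [IsLocallyConstant.iff_eventually_eq]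
  intro x
  have hc : ∀ j, Continuous T.symm^[j] := fun j => T.symm.continuous.iterate j
  have h1 : ∀ᶠ y in nhds x, T.symm^[age hvisit x] y ∈ B :=
    (hc _).continuousAt.eventually (hB.isOpen.mem_nhds (lastVisit_mem hvisit x))
  have h2 : ∀ᶠ y in nhds x, ∀ j ∈ Finset.range (age hvisit x), T.symm^[j] y ∈ Bᶜ := by
    rw [Filter.eventually_all_finset]
    intro j hj
    exact (hc j).continuousAt.eventually
      (hB.compl.isOpen.mem_nhds (notMem_of_lt_age hvisit (Finset.mem_range.1 hj)))
  filter_upwards [h1, h2] with y hy1 hy2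
  exact (age_eq_iff hvisit).2 ⟨hy1, fun j hj => hy2 j (Finset.mem_range.2 hj)⟩

/-- Otherwise the first return after the last visit would be a more recent visit. -/
theorem age_lt {x : X} {r : ℕ} (hr : IsReturnTime T B (lastVisit hvisit x) r) :
    age hvisit x < r := by
  by_contra! hle
  refine notMem_of_lt_age hvisit (x := x) (k := age hvisit x - r) (by have := hr.1; omega) ?_
  have h := hr.2.1
  have h2 : age hvisit x = r + (age hvisit x - r) := by omega
  rw [lastVisit, h2, Function.iterate_add_apply, iterate_symm_iterate] at h
  exact h

/-- The partition into towers over a clopen base `B` divided by a label that determines the time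
of return to `B`. -/
noncomputable def ofBase (ι : Type) [Finite ι] (label : X → ι) (height : ι → ℕ)
    (hlabel : ∀ x ∈ B, ∀ᶠ y in nhds x, label y = label x)
    (hret : ∀ x ∈ B, IsReturnTime T B x (height (label x)))
    (hsurj : ∀ v, ∃ x ∈ B, label x = v) : KRPartition T where
  ι := ι
  finite_ι := inferInstance
  height := height
  vtx x := label (lastVisit hvisit x)
  lvl := age hvisit
  vtx_loc := by
    rw [IsLocallyConstant.iff_eventually_eq]
    intro x
    have hc : Continuous T.symm^[age hvisit x] := T.symm.continuous.iterate _
    filter_upwards [(isLocallyConstant_age hB hvisit).eventually_eq x,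
      hc.continuousAt.eventually (hlabel _ (lastVisit_mem hvisit x))] with y h1 h2
    rw [lastVisit, h1, h2, lastVisit]
  lvl_loc := isLocallyConstant_age hB hvisit
  lvl_lt x := age_lt hvisit (hret _ (lastVisit_mem hvisit x))
  map_of_lt x h := by
    have hn : T x ∉ B := by
      rw [← iterate_succ_age_lastVisit hvisit]
      exact (hret _ (lastVisit_mem hvisit x)).2.2 _ (Nat.succ_pos _) h
    exact ⟨by rw [lastVisit_map_of_notMem hvisit hn], age_map_of_notMem hvisit hn⟩
  map_of_top x h := by
    refine age_of_mem hvisit ?_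
    rw [← iterate_succ_age_lastVisit hvisit, h]
    exact (hret _ (lastVisit_mem hvisit x)).2.1
  vtx_surjective v := by
    obtain ⟨x, hx, rfl⟩ := hsurj v
    exact ⟨x, by simp [lastVisit, age_of_mem hvisit hx]⟩

end OfBase

end KRPartition

/-- A minimal system on a finite space has a Bratteli–Vershik representation with one vertex at
each level. -/
theorem IsMinimalHomeo.topologicalRank_le_one [Finite X] [T1Space X] [Nonempty X]
    (hT : IsMinimalHomeo T) : topologicalRank T ≤ 1 := by
  have : DiscreteTopology X := Finite.instDiscreteTopology
  let z : X := Classical.arbitrary X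
  have hB : IsClopen ({z} : Set X) := isClopen_discrete _
  have hvisit := hT.exists_symm_iterate_mem hB.isOpen (singleton_nonempty z)
  obtain ⟨r, hr⟩ := hT.exists_isReturnTime hB.isOpen (singleton_nonempty z) z
  let Q : KRPartition T := KRPartition.ofBase hB hvisit Unit (fun _ => ()) (fun _ => r)
    (fun _ _ => Eventually.of_forall fun _ => rfl) (by simpa using hr) (fun _ => ⟨z, rfl, rfl⟩)
  have hQ : ∀ x, T^[Q.lvl x] z = x := by
    intro x
    have h1 : KRPartition.lastVisit hvisit x = z := KRPartition.lastVisit_mem hvisit x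
    have h2 := KRPartition.iterate_age_lastVisit hvisit x
    rwa [h1] at h2
  let P : ℕ → KRPartition T := fun n => Nat.casesOn n (KRPartition.trivial T) (fun _ => Q)
  have hP : ∀ n, (P (n + 1)).Refines (P n) := by
    intro n
    cases n with
    | zero => exact ⟨fun _ _ _ _ => ⟨rfl, rfl⟩, fun _ _ => rfl⟩
    | succ n => exact ⟨fun _ _ h1 h2 => ⟨h1, h2⟩, fun _ h => h⟩
  have hcard : ∀ n, Nat.card (P n).ι = 1 := by
    intro n
    cases n <;> exact Nat.card_unique (α := Unit)
  have hz : Q.lvl z = 0 := KRPartition.age_of_mem hvisit rfl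
  refine iInf₂_le 1 ⟨KRPartition.diagram P hP (hcard 0), ?_, fun n => (hcard n).le⟩
  refine KRPartition.isBratteliVershikRep_diagram hP (hcard 0) (fun _ => rfl) ?_ ?_ ?_
  · intro x y h
    rw [← hQ x, ← hQ y, show Q.lvl x = Q.lvl y from (h 1).2]
  · refine ⟨z, fun n => ?_, fun y hy => ?_⟩
    · cases n
      · rfl
      · exact hz
    · have := hQ y
      rw [show Q.lvl y = 0 from hy 1] at this
      exact this.symm
  · intro n hn
    refine ⟨n + 1, by omega, fun u v => ⟨z, ?_, rfl⟩⟩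
    have := (Nat.card_eq_one_iff_unique.1 (hcard n)).1
    exact Subsingleton.elim _ _

end Minimal

namespace SymbolicDynamics.FullShift.Subshift

/-! ### Windows, occurrences and right special words -/

section Words

variable {A : Type*}

/-- The word of length `n` of `x` that ends just before the position `t`. -/
def window (n : ℕ) (x : ℤ → A) (t : ℤ) : Fin n → A := fun i => x (t - n + (i : ℕ))

theorem window_eq_window_iff {n : ℕ} {x y : ℤ → A} {s t : ℤ} :
    window n x s = window n y t ↔ ∀ i : ℤ, -n ≤ i → i < 0 → x (s + i) = y (t + i) := by
  constructor
  · intro h i h1 h2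
    have := congrFun h ⟨(i + n).toNat, by omega⟩
    simp only [window] at this
    convert this using 2 <;> omega
  · intro h
    funext i
    have := h (-n + (i : ℕ)) (by omega) (by have := i.2; omega)
    simp only [window]
    convert this using 2 <;> ring

theorem window_congr {n : ℕ} {x y : ℤ → A} {t : ℤ} (h : ∀ i, t - n ≤ i → i < t → x i = y i) :
    window n x t = window n y t :=
  window_eq_window_iff.2 fun i h1 h2 => h _ (by omega) (by omega)

/-- The points `x` and `y` agree on `[-L, L)`. -/
def Agree (L : ℕ) (x y : ℤ → A) : Prop := ∀ i : ℤ, -L ≤ i → i < L → x i = y i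

/-- The central word `u_{[-L, L)}` occurs in `x` around the position `e`. -/
def Occurs (u : ℤ → A) (L : ℕ) (x : ℤ → A) (e : ℤ) : Prop :=
  ∀ i : ℤ, -L ≤ i → i < L → x (e + i) = u i

theorem Occurs.congr {u : ℤ → A} {L : ℕ} {x y : ℤ → A} {e d : ℤ}
    (h : ∀ i, e - L ≤ i → i < e + L → x i = y (d + i)) (hx : Occurs u L x e) :
    Occurs u L y (d + e) := by
  intro i h1 h2
  rw [← hx i h1 h2, h (e + i) (by omega) (by omega), add_assoc]

theorem Occurs.congr' {u : ℤ → A} {L : ℕ} {x y : ℤ → A} {e : ℤ}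
    (h : ∀ i, e - L ≤ i → i < e + L → x i = y i) (hx : Occurs u L x e) :
    Occurs u L y e := by
  intro i h1 h2
  rw [← hx i h1 h2, h (e + i) (by omega) (by omega)]

end Words

/-! ### Counting right special words -/

section Special

variable {A : Type*} [TopologicalSpace A] (X : Subshift A ℤ)

/-- The right special words of length `n`: those that are followed by different letters in
different occurrences. -/
def rightSpecial (n : ℕ) : Set (Fin n → A) :=
  {w | ∃ x ∈ X.carrier, ∃ y ∈ X.carrier, ∃ s t : ℤ,
    window n x s = w ∧ window n y t = w ∧ x s ≠ y t}

variable {X}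

theorem eq_of_window_eq {n : ℕ} {x y : ℤ → A} (hx : x ∈ X.carrier) (hy : y ∈ X.carrier)
    {s t : ℤ} (h : window n x s = window n y t) (hs : window n x s ∉ X.rightSpecial n) :
    x s = y t := by
  by_contra hne
  exact hs ⟨x, hx, y, hy, s, t, rfl, h.symm, hne⟩

-- Every word of length `n` has an extension `f w`, and a right special one has a second extension
-- `g w`; all these words of length `n + 1` are distinct.
variable (X) in
theorem ncard_rightSpecial_le [Finite A] (n : ℕ) :
    (X.rightSpecial n).ncard ≤ X.complexity (n + 1) - X.complexity n := by
  classical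
  rcases (X.rightSpecial n).eq_empty_or_nonempty with h0 | ⟨-, x₀, -, -, -, -, -, -, -, -⟩
  · simp [h0]
  have : Nonempty A := ⟨x₀ 0⟩
  let c (w : Fin n → A) (a : A) : Fin (n + 1) → A := Fin.snoc w a
  have hc : ∀ {w w' a a'}, c w a = c w' a' → w = w' ∧ a = a' := by
    intro w w' a a' h
    exact Fin.snoc_injective2 h
  have hmem : ∀ x ∈ X.carrier, ∀ t, c (window n x t) (x t) ∈ X.words (n + 1) := by
    intro x hx t
    refine ⟨x, hx, t - n, fun i => ?_⟩
    refine Fin.lastCases ?_ (fun i => ?_) i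
    · simp [c]
    · simp [c, window]
  have h1 : ∀ w ∈ X.words n, ∃ a, c w a ∈ X.words (n + 1) := by
    rintro w ⟨x, hx, m, hw⟩
    obtain rfl : window n x (m + n) = w := by
      funext i
      simp [window, hw i]
    exact ⟨_, hmem x hx _⟩
  choose! f hf using h1
  have h2 : ∀ w ∈ X.rightSpecial n, ∃ a, c w a ∈ X.words (n + 1) ∧ a ≠ f w := by
    rintro w ⟨x, hx, y, hy, s, t, h1, h2, hne⟩
    by_cases h : x s = f w
    · exact ⟨y t, h2 ▸ hmem y hy t, fun h' => hne (h.trans h'.symm)⟩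
    · exact ⟨x s, h1 ▸ hmem x hx s, h⟩
  choose! g hg hgf using h2
  have hdisj : Disjoint ((fun w => c w (f w)) '' X.words n)
      ((fun w => c w (g w)) '' X.rightSpecial n) := by
    rw [Set.disjoint_left]
    rintro _ ⟨w, hw, rfl⟩ ⟨w', hw', h⟩
    obtain ⟨rfl, h⟩ := hc h
    exact hgf _ hw' h
  have hsub : (fun w => c w (f w)) '' X.words n ∪ (fun w => c w (g w)) '' X.rightSpecial n ⊆
      X.words (n + 1) := by
    rintro _ (⟨w, hw, rfl⟩ | ⟨w, hw, rfl⟩)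
    exacts [hf w hw, hg w hw]
  have h3 := Set.ncard_le_ncard hsub (Set.toFinite _)
  rw [Set.ncard_union_eq hdisj (Set.toFinite _) (Set.toFinite _),
    Set.ncard_image_of_injective _ (fun w w' h => (hc h).1),
    Set.ncard_image_of_injective _ (fun w w' h => (hc h).1)] at h3
  unfold complexity
  omega

end Special

/-! ### Minimal subshifts -/

section Minimal

variable {A : Type*} [TopologicalSpace A] {X : Subshift A ℤ}

theorem shiftHomeo_zpow_apply (k : ℤ) (x : X.carrier) (i : ℤ) :
    ((X.shiftHomeo ^ k) x).1 i = x.1 (i + k) := by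
  have hs : ∀ y : X.carrier, ∀ i, (X.shiftHomeo y).1 i = y.1 (i + 1) := fun _ _ => rfl
  have hs' : ∀ y : X.carrier, ∀ i, (X.shiftHomeo⁻¹ y).1 i = y.1 (i - 1) := fun _ _ => rfl
  induction k generalizing i with
  | zero => simp
  | succ k ih =>
    rw [add_comm, zpow_add, zpow_one, Homeomorph.mul_apply, hs, ih]
    exact congrArg x.1 (by ring)
  | pred k ih =>
    rw [sub_eq_neg_add, zpow_add, zpow_neg_one, Homeomorph.mul_apply, hs', ih]
    exact congrArg x.1 (by ring)

theorem shiftHomeo_iterate_apply (k : ℕ) (x : X.carrier) (i : ℤ) :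
    (X.shiftHomeo^[k] x).1 i = x.1 (i + k) := by
  rw [← Homeomorph.zpow_natCast_apply, shiftHomeo_zpow_apply]

theorem exists_shift (k : ℤ) {x : ℤ → A} (hx : x ∈ X.carrier) :
    ∃ y : X.carrier, ∀ i, y.1 i = x (i + k) :=
  ⟨(X.shiftHomeo ^ k) ⟨x, hx⟩, shiftHomeo_zpow_apply k ⟨x, hx⟩⟩

instance [Finite A] : CompactSpace X.carrier :=
  isCompact_iff_compactSpace.1 X.isClosed.isCompact

theorem isClopen_agree [DiscreteTopology A] (L : ℕ) (u : ℤ → A) :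
    IsClopen {x : X.carrier | Agree L x.1 u} := by
  have h : {x : X.carrier | Agree L x.1 u} =
      ⋂ i ∈ Finset.Ico (-L : ℤ) L, {x : X.carrier | x.1 i = u i} := by
    ext x
    simp [Agree]
  rw [h]
  refine isClopen_biInter_finset fun i _ => ?_
  exact (isClopen_discrete {u i}).preimage ((continuous_apply i).comp continuous_subtype_val)

theorem exists_agree_subset [DiscreteTopology A] {U : Set X.carrier} (hU : IsOpen U)
    {x : X.carrier} (hx : x ∈ U) : ∃ L : ℕ, ∀ y : X.carrier, Agree L x.1 y.1 → y ∈ U := by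
  obtain ⟨V, hV, rfl⟩ := isOpen_induced_iff.1 hU
  obtain ⟨I, u, hu, hsub⟩ := isOpen_pi_iff.1 hV x.1 hx
  refine ⟨I.sup Int.natAbs + 1, fun y hy => hsub fun i hi => ?_⟩
  have hle : i.natAbs ≤ I.sup Int.natAbs := Finset.le_sup (f := Int.natAbs) hi
  rw [← hy i (by omega) (by omega)]
  exact (hu i hi).2

theorem isClopen_of_agree [DiscreteTopology A] {B : Set X.carrier} (L : ℕ)
    (h : ∀ x y : X.carrier, Agree L x.1 y.1 → x ∈ B → y ∈ B) : IsClopen B := by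
  have hsymm : ∀ {x y : X.carrier}, Agree L x.1 y.1 → Agree L y.1 x.1 :=
    fun h i h1 h2 => (h i h1 h2).symm
  constructor
  · rw [← isOpen_compl_iff, isOpen_iff_mem_nhds]
    intro x hx
    filter_upwards [(isClopen_agree L x.1).isOpen.mem_nhds fun _ _ _ => rfl] with y hy hyB
    exact hx (h _ _ hy hyB)
  · rw [isOpen_iff_mem_nhds]
    intro x hx
    filter_upwards [(isClopen_agree L x.1).isOpen.mem_nhds fun _ _ _ => rfl] with y hy
    exact h _ _ (hsymm hy) hx

/-- By compactness, a locally constant function depends on finitely many coordinates, uniformly. -/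
theorem _root_.IsLocallyConstant.exists_agree [DiscreteTopology A] [Finite A] {Y : Type*}
    {f : X.carrier → Y} (hf : IsLocallyConstant f) :
    ∃ L : ℕ, ∀ L' ≥ L, ∀ x y : X.carrier, Agree L' x.1 y.1 → f x = f y := by
  let U : ℕ → Set X.carrier := fun L => {x | ∀ y : X.carrier, Agree L x.1 y.1 → f x = f y}
  have hU : ∀ L, IsOpen (U L) := fun L => by
    refine (isClopen_of_agree (B := U L) L fun x y h hx z hz => ?_).isOpen
    rw [← hx y h, hx z fun i h1 h2 => (h i h1 h2).trans (hz i h1 h2)]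
  have hmono : Monotone U := fun L L' hL x hx y h =>
    hx y fun i h1 h2 => h i (by omega) (by omega)
  obtain ⟨L, hL⟩ := isCompact_univ.elim_directed_cover U hU
    (fun x _ => by
      obtain ⟨L, hL⟩ := exists_agree_subset (hf.isOpen_fiber (f x)) (rfl : f x = f x)
      exact mem_iUnion.2 ⟨L, fun y hy => (hL y hy).symm⟩)
    hmono.directed_le
  exact ⟨L, fun L' hL' x y h => hmono hL' (hL (mem_univ x)) y h⟩

/-- An infinite minimal subshift has no periodic point. -/
theorem exists_ne_of_infinite [DiscreteTopology A] (hmin : IsMinimalHomeo X.shiftHomeo)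
    (hinf : X.carrier.Infinite) {p : ℕ} (hp : 0 < p) (x : X.carrier) :
    ∃ i : ℤ, x.1 i ≠ x.1 (i + p) := by
  by_contra! h
  have hper : ∀ i k : ℤ, x.1 (i + p * k) = x.1 i := by
    intro i k
    induction k with
    | zero => simp
    | succ k ih => rw [mul_add, mul_one, ← add_assoc, ← h, ih]
    | pred k ih => rw [h, ← ih]; exact congrArg x.1 (by ring)
  have hfin : (Set.range fun n : ℤ => (X.shiftHomeo ^ n) x).Finite := by
    refine ((Finset.Ico (0 : ℤ) p).finite_toSet.image fun n : ℤ => (X.shiftHomeo ^ n) x).subset ?_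
    rintro _ ⟨n, rfl⟩
    refine ⟨n % p, ?_, ?_⟩
    · simp only [Finset.coe_Ico, mem_Ico]
      exact ⟨Int.emod_nonneg _ (by omega), Int.emod_lt_of_pos _ (by omega)⟩
    · refine Subtype.ext (funext fun i => ?_)
      simp only [shiftHomeo_zpow_apply]
      rw [← hper (i + n % p) (n / p)]
      have := Int.emod_add_mul_ediv n p
      exact congrArg x.1 (by linarith)
  have huniv := (hmin x).closure_eq
  rw [hfin.isClosed.closure_eq] at huniv
  rw [huniv] at hfin
  exact hinf (Set.finite_coe_iff.1 (Set.finite_univ_iff.1 hfin))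

/-- In an infinite minimal subshift, words with a given period have bounded lengths. -/
theorem exists_bound_of_period [DiscreteTopology A] [Finite A]
    (hmin : IsMinimalHomeo X.shiftHomeo) (hinf : X.carrier.Infinite) (M : ℕ) :
    ∃ D : ℕ, ∀ p : ℕ, 0 < p → p ≤ M → ∀ x ∈ X.carrier, ∀ t : ℤ,
      ∃ i, t ≤ i ∧ i < t + D ∧ x i ≠ x (i + p) := by
  have key : ∀ p : ℕ, 0 < p → ∃ D : ℕ, ∀ x ∈ X.carrier, ∀ t : ℤ,
      ∃ i, t ≤ i ∧ i < t + D ∧ x i ≠ x (i + p) := by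
    intro p hp
    have hopen : ∀ i : ℤ, IsOpen {x : X.carrier | x.1 i ≠ x.1 (i + p)} := fun i => by
      have hc : ∀ j, Continuous fun x : X.carrier => x.1 j :=
        fun j => (continuous_apply j).comp continuous_subtype_val
      exact isOpen_ne_fun (hc _) (hc _)
    obtain ⟨F, hF⟩ := (isCompact_univ (X := X.carrier)).elim_finite_subcover _ hopen
      fun x _ => mem_iUnion.2 (exists_ne_of_infinite hmin hinf hp x)
    -- Compactness gives a window centred at 0; it is recentred so that it begins at `t`.
    refine ⟨2 * F.sup Int.natAbs + 1, fun x hx t => ?_⟩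
    obtain ⟨y, hy⟩ := exists_shift (t + F.sup Int.natAbs) hx
    obtain ⟨i, hi, hne⟩ := mem_iUnion₂.1 (hF (mem_univ y))
    have hle : i.natAbs ≤ F.sup Int.natAbs := Finset.le_sup (f := Int.natAbs) hi
    refine ⟨i + (t + F.sup Int.natAbs), by omega, by push_cast; omega, ?_⟩
    have hne' : y.1 i ≠ y.1 (i + p) := hne
    rw [hy, hy] at hne'
    convert hne' using 2
    ring
  choose! D hD using key
  refine ⟨(Finset.range (M + 1)).sup D, fun p hp hpM x hx t => ?_⟩
  obtain ⟨i, h1, h2, h3⟩ := hD p hp x hx t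
  have : D p ≤ (Finset.range (M + 1)).sup D := Finset.le_sup (Finset.mem_range.2 (by omega))
  exact ⟨i, h1, by omega, h3⟩

/-- Without right special words each window forces all later letters, so a repeated window makes the
point periodic to the right, which `exists_bound_of_period` excludes. -/
theorem rightSpecial_nonempty [DiscreteTopology A] [Finite A]
    (hmin : IsMinimalHomeo X.shiftHomeo) (hinf : X.carrier.Infinite) (n : ℕ) :
    (X.rightSpecial n).Nonempty := by
  by_contra! hempty
  obtain ⟨x, hx⟩ := hinf.nonempty
  obtain ⟨s, t, hst, heq⟩ : ∃ s t : ℕ, s < t ∧ window n x s = window n x t := by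
    obtain ⟨s, t, hne, h⟩ :=
      Finite.exists_ne_map_eq_of_infinite fun t : ℕ => window n x t
    rcases lt_or_gt_of_ne hne with h' | h'
    exacts [⟨s, t, h', h⟩, ⟨t, s, h', h.symm⟩]
  have hall : ∀ k : ℕ, window n x (s + k) = window n x (t + k) := by
    intro k
    induction k with
    | zero => simpa using heq
    | succ k ih =>
      have h0 := eq_of_window_eq hx hx ih (by simp [hempty])
      rw [window_eq_window_iff] at ih ⊢
      intro i h1 h2
      rcases eq_or_ne i (-1) with rfl | hi
      · convert h0 using 2 <;> push_cast <;> ring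
      · convert ih (i + 1) (by omega) (by omega) using 2 <;> push_cast <;> ring
  obtain ⟨D, hD⟩ := exists_bound_of_period hmin hinf (t - s)
  obtain ⟨i, h1, h2, h3⟩ := hD (t - s) (by omega) le_rfl x hx s
  refine h3 ?_
  have := eq_of_window_eq hx hx (hall (i - s).toNat) (by simp [hempty])
  convert this using 2 <;> omega

end Minimal

end SymbolicDynamics.FullShift.Subshift

namespace SymbolicDynamics.FullShift.Subshift

/-! ### Clopen sets with few return words -/

section Marks

universe u

variable {A : Type u} [TopologicalSpace A] {X : Subshift A ℤ} {u : ℤ → A} {L M n : ℕ}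

omit [TopologicalSpace A] in
theorem occurs_shift_iff {x y : ℤ → A} {k : ℤ} (h : ∀ i, y i = x (i + k)) {e : ℤ} :
    Occurs u L y e ↔ Occurs u L x (e + k) := by
  refine forall_congr' fun i => ?_
  rw [h, add_right_comm]

omit [TopologicalSpace A] in
theorem window_shift {x y : ℤ → A} {k : ℤ} (h : ∀ i, y i = x (i + k)) (t : ℤ) :
    window n y t = window n x (t + k) :=
  window_eq_window_iff.2 fun i _ _ => by rw [h, add_right_comm]

variable (X u L n) in
/-- The position `e` is marked in `x` if it is the last occurrence of the central word of `u`
before some right special word of length `n`. -/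
def IsMark (x : ℤ → A) (e : ℤ) : Prop :=
  Occurs u L x e ∧ ∃ t, e + L ≤ t ∧ window n x t ∈ X.rightSpecial n ∧
    ∀ d, e < d → d ≤ t - L → ¬ Occurs u L x d

theorem isMark_shift_iff {x y : ℤ → A} {k : ℤ} (h : ∀ i, y i = x (i + k)) {e : ℤ} :
    X.IsMark u L n y e ↔ X.IsMark u L n x (e + k) := by
  unfold IsMark
  rw [occurs_shift_iff h]
  refine and_congr_right fun _ => ⟨?_, ?_⟩
  · rintro ⟨t, h1, h2, h3⟩
    refine ⟨t + k, by omega, window_shift h t ▸ h2, fun d hd hd' ho => ?_⟩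
    refine h3 (d - k) (by omega) (by omega) ((occurs_shift_iff h).2 ?_)
    rwa [sub_add_cancel]
  · rintro ⟨t, h1, h2, h3⟩
    refine ⟨t - k, by omega, ?_, fun d hd hd' ho => ?_⟩
    · rwa [window_shift h, sub_add_cancel]
    · exact h3 (d + k) (by omega) (by omega) ((occurs_shift_iff h).1 ho)

/-- Every right special word is preceded by a mark, namely the last occurrence before it. -/
theorem exists_isMark {x : ℤ → A} {t : ℤ} (ht : window n x t ∈ X.rightSpecial n)
    (ho : ∃ e ≤ t - L, Occurs u L x e) :
    ∃ e ≤ t - L, X.IsMark u L n x e ∧ ∀ d ≤ t - L, Occurs u L x d → d ≤ e := by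
  obtain ⟨e, ⟨h1, h2⟩, h3⟩ := Int.exists_greatest_of_bdd
    (P := fun e => e ≤ t - L ∧ Occurs u L x e) ⟨t - L, fun z hz => hz.1⟩ ho
  refine ⟨e, h1, ⟨h2, t, by omega, ht, fun d hd hd' hod => ?_⟩, fun d hd hod => h3 d ⟨hd, hod⟩⟩
  have := h3 d ⟨hd', hod⟩
  omega

variable (hM : ∀ x ∈ X.carrier, ∀ t : ℤ, ∃ e, t < e ∧ e ≤ t + M ∧ Occurs u L x e)
  (hn : M + 2 * L ≤ n)
  (hD : ∀ p : ℕ, 0 < p → p ≤ M → ∀ x ∈ X.carrier, ∀ t : ℤ,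
    ∃ i, t ≤ i ∧ i < t + n ∧ x i ≠ x (i + p))

-- Two nearby equal windows would form a word of length `n` with period at most `M`.
include hD in
theorem eq_of_window_eq_of_near {x : ℤ → A} (hx : x ∈ X.carrier) {s t : ℤ} (h1 : s - t ≤ M)
    (h2 : t - s ≤ M) (h : window n x s = window n x t) : s = t := by
  wlog hst : s ≤ t generalizing s t
  · exact (this h2 h1 h.symm (by omega)).symm
  by_contra hne
  obtain ⟨i, hi1, hi2, hi3⟩ := hD (t - s).toNat (by omega) (by omega) x hx (s - n)
  refine hi3 ?_
  have := window_eq_window_iff.1 h (i - s) (by omega) (by omega)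
  convert this using 2 <;> omega

include hM in
theorem lt_of_forall_not_occurs {x : ℤ → A} (hx : x ∈ X.carrier) {t : ℤ}
    (h : ∀ d, 0 < d → d ≤ t - L → ¬ Occurs u L x d) : t < M + L := by
  obtain ⟨e, h1, h2, h3⟩ := hM x hx 0
  by_contra hlt
  exact h e h1 (by omega) h3

variable (X L n) in
/-- The position `t` is the first one, from `L` on, at which a right special word ends. -/
def IsFirstSpecial (x : ℤ → A) (t : ℤ) : Prop :=
  L ≤ t ∧ window n x t ∈ X.rightSpecial n ∧
    ∀ s : ℤ, L ≤ s → s < t → window n x s ∉ X.rightSpecial n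

theorem IsMark.exists_isFirstSpecial {x : ℤ → A} (hx : X.IsMark u L n x 0) :
    ∃ t, X.IsFirstSpecial L n x t ∧ ∀ d, 0 < d → d ≤ t - L → ¬ Occurs u L x d := by
  obtain ⟨-, t₁, h1, h2, h3⟩ := hx
  obtain ⟨t, ⟨h4, h5⟩, h6⟩ := Int.exists_least_of_bdd
    (P := fun t => L ≤ t ∧ window n x t ∈ X.rightSpecial n)
    ⟨L, fun z hz => hz.1⟩ ⟨t₁, by omega, h2⟩
  have h7 := h6 t₁ ⟨by omega, h2⟩
  refine ⟨t, ⟨h4, h5, fun s hs hst hsp => ?_⟩, fun d hd hd' => h3 d hd (by omega)⟩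
  have := h6 s ⟨hs, hsp⟩
  omega

-- The window is long enough to contain the occurrence of the central word at 0 in `x`. If it ended
-- later in `y`, that occurrence would be copied to a positive position of `y` where none is
-- allowed.
omit [TopologicalSpace A] in
include hn in
theorem le_of_window_eq {x y : ℤ → A} {s t : ℤ} (hx : Occurs u L x 0) (hs : L ≤ s)
    (hsM : s < M + L) (ht : ∀ d, 0 < d → d ≤ t - L → ¬ Occurs u L y d)
    (h : window n x s = window n y t) : t ≤ s := by
  by_contra! hlt
  refine ht (t - s + 0) (by omega) (by omega) (hx.congr fun i h1 h2 => ?_)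
  have := window_eq_window_iff.1 h (i - s) (by omega) (by omega)
  convert this using 2 <;> ring

/-- Two marked points agree up to the next mark if the right special words met before are the
same and are followed by the same letters. -/
theorem agree_of_window_eq {x y : ℤ → A} (hx : x ∈ X.carrier) (hy : y ∈ X.carrier)
    {t₀ t₁ : ℤ} (h₀ : X.IsFirstSpecial L n x t₀)
    (hw : ∀ i, t₀ - n ≤ i → i < t₀ → x i = y i) (hn' : L ≤ n - t₀)
    (hc : ∀ t, t < t₁ → window n x t ∈ X.rightSpecial n → window n x t = window n y t →
      L ≤ t → (∀ i : ℤ, -L ≤ i → i < t → x i = y i) → x t = y t) :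
    ∀ i : ℤ, t₀ - n ≤ i → i < t₁ → x i = y i := by
  have key : ∀ k : ℕ, ∀ i : ℤ, t₀ - n ≤ i → i < t₀ + k → i < t₁ → x i = y i := by
    intro k
    induction k with
    | zero => exact fun i h1 h2 _ => hw i h1 (by simpa using h2)
    | succ k ih =>
      intro i h1 h2 h3
      rcases lt_or_ge i (t₀ + k) with h4 | h4
      · exact ih i h1 h4 h3
      obtain rfl : i = t₀ + k := by omega
      have hwin : window n x (t₀ + k) = window n y (t₀ + k) :=
        window_congr fun j hj1 hj2 => ih j (by omega) hj2 (by omega)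
      -- A window that is not right special forces the next letter; at a right special one, `hc`
      -- supplies it.
      by_cases hsp : window n x (t₀ + k) ∈ X.rightSpecial n
      · have := h₀.1
        exact hc _ h3 hsp hwin (by omega) fun j hj1 hj2 => ih j (by omega) hj2 (by omega)
      · exact eq_of_window_eq hx hy hwin hsp
  exact fun i h1 h2 => key (i - t₀ + 1).toNat i h1 (by omega) h2

/-- A marked point determines the next mark of the points that agree with it. -/
theorem isMark_next_of_agree {x y : ℤ → A} (hx : x ∈ X.carrier) (hy : y ∈ X.carrier)
    {t₀ : ℤ} (h₀ : X.IsFirstSpecial L n x t₀) (h₀' : X.IsFirstSpecial L n y t₀)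
    (hw : ∀ i, t₀ - n ≤ i → i < t₀ → x i = y i) (hn' : L ≤ n - t₀)
    (hc : ∀ t, window n x t ∈ X.rightSpecial n → window n x t = window n y t → L ≤ t →
      (∀ d, 0 < d → d ≤ t - L → ¬ Occurs u L x d) →
      (∀ d, 0 < d → d ≤ t - L → ¬ Occurs u L y d) → x t = y t)
    {r : ℤ} (hr0 : 0 < r) (hr : X.IsMark u L n x r)
    (hrmin : ∀ j, 0 < j → j < r → ¬ X.IsMark u L n x j) :
    X.IsMark u L n y r ∧ (∀ j, 0 < j → j < r → ¬ X.IsMark u L n y j) ∧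
      ∀ i, 0 ≤ i → i < r → x i = y i := by
  obtain ⟨hor, s, hs1, hs2, hs3⟩ := hr
  -- Agreement is carried to `t₁`, the first end of a right special word that witnesses the mark at
  -- `r`, so that `y` inherits the witness as well as the occurrence.
  obtain ⟨t₁, ⟨h1, h2⟩, h3⟩ := Int.exists_least_of_bdd
    (P := fun t => r + L ≤ t ∧ window n x t ∈ X.rightSpecial n)
    ⟨r + L, fun z hz => hz.1⟩ ⟨s, hs1, hs2⟩
  have hts := h3 s ⟨hs1, hs2⟩
  have h₀t : t₀ ≤ t₁ := by
    by_contra! hlt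
    exact h₀.2.2 t₁ (by omega) hlt h2
  have hag := agree_of_window_eq (t₁ := t₁) hx hy h₀ hw hn' fun t ht hsp hwin hLt hagt => by
    have hrt : t < r + L := by
      by_contra! hle
      have := h3 t ⟨hle, hsp⟩
      omega
    -- An occurrence between 0 and the end of a right special word before `r + L` would create a
    -- mark strictly between 0 and `r`.
    have hno : ∀ d, 0 < d → d ≤ t - L → ¬ Occurs u L x d := by
      intro d hd hdt hod
      obtain ⟨e, he1, he2, he3⟩ := exists_isMark hsp ⟨d, hdt, hod⟩
      have := he3 d hdt hod
      exact hrmin e (by omega) (by omega) he2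
    refine hc t hsp hwin hLt hno fun d hd hdt hod => ?_
    exact hno d hd hdt (hod.congr' fun i hi1 hi2 => (hagt i (by omega) (by omega)).symm)
  have h₀L := h₀.1
  refine ⟨⟨hor.congr' fun i hi1 hi2 => hag i (by omega) (by omega), t₁, h1, ?_, ?_⟩, ?_, ?_⟩
  · rwa [← window_congr fun i hi1 hi2 => hag i (by omega) hi2]
  · intro d hd hdt hod
    exact hs3 d hd (by omega)
      (hod.congr' fun i hi1 hi2 => (hag i (by omega) (by omega)).symm)
  -- The occurrence at `r` forces the witness of a mark at `j` to end before `r + L`, hence inside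
  -- the range of agreement, and the mark passes to `x`.
  · rintro j hj0 hjr ⟨hoj, t, ht1, ht2, ht3⟩
    have htr : t < r + L := by
      by_contra! hle
      exact ht3 r hjr (by omega) (hor.congr' fun i hi1 hi2 => hag i (by omega) (by omega))
    have ht₀ : t₀ ≤ t := by
      by_contra! hlt
      exact h₀'.2.2 t (by omega) hlt ht2
    refine hrmin j hj0 hjr
      ⟨hoj.congr' fun i hi1 hi2 => (hag i (by omega) (by omega)).symm, t, ht1, ?_, ?_⟩
    · rwa [window_congr fun i hi1 hi2 => hag i (by omega) (by omega)]
    · intro d hd hdt hod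
      exact ht3 d hd hdt (hod.congr' fun i hi1 hi2 => hag i (by omega) (by omega))
  · exact fun i hi1 hi2 => hag i (by omega) (by omega)

variable (X u L n) in
open Classical in
/-- The first right special word met by a marked point, together with the letters following the
right special words met before the next occurrence of the central word of `u`. -/
noncomputable def code (x : ℤ → A) : Option (X.rightSpecial n) × (X.rightSpecial n → A) :=
  (if h : ∃ t, X.IsFirstSpecial L n x t then some ⟨window n x h.choose, h.choose_spec.2.1⟩
    else none,
   fun w => if h : ∃ t : ℤ, L ≤ t ∧ (∀ d, 0 < d → d ≤ t - L → ¬ Occurs u L x d) ∧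
      window n x t = w.1 then x h.choose else x 0)

theorem nat_card_code [Finite A] :
    Nat.card (Option (X.rightSpecial n) × (X.rightSpecial n → A)) =
      ((X.rightSpecial n).ncard + 1) * Nat.card A ^ (X.rightSpecial n).ncard := by
  rw [Nat.card_prod, Finite.card_option, Nat.card_fun, Nat.card_coe_set_eq]

include hM hn in
/-- Marked points with the same code meet their first right special word at the same time, and
agree before. -/
theorem exists_isFirstSpecial_of_code_eq {x y : ℤ → A} (hx : x ∈ X.carrier) (hy : y ∈ X.carrier)
    (hxm : X.IsMark u L n x 0) (hym : X.IsMark u L n y 0)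
    (h : X.code u L n x = X.code u L n y) :
    ∃ t₀ : ℤ, X.IsFirstSpecial L n x t₀ ∧ X.IsFirstSpecial L n y t₀ ∧ t₀ < M + L ∧
      ∀ i, t₀ - n ≤ i → i < t₀ → x i = y i := by
  have hex : ∃ t, X.IsFirstSpecial L n x t := hxm.exists_isFirstSpecial.imp fun t ht => ht.1
  have hey : ∃ t, X.IsFirstSpecial L n y t := hym.exists_isFirstSpecial.imp fun t ht => ht.1
  have hu : ∀ {z : ℤ → A} {s t : ℤ}, X.IsFirstSpecial L n z s → X.IsFirstSpecial L n z t →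
      s = t := by
    intro z s t hs ht
    rcases lt_trichotomy s t with hlt | heq | hlt
    · exact absurd hs.2.1 (ht.2.2 s hs.1 hlt)
    · exact heq
    · exact absurd ht.2.1 (hs.2.2 t ht.1 hlt)
  have h1 := congrArg Prod.fst h
  simp only [code, dif_pos hex, dif_pos hey, Option.some.injEq, Subtype.mk.injEq] at h1
  obtain ⟨s, hs, hs'⟩ := hxm.exists_isFirstSpecial
  obtain ⟨t, ht, ht'⟩ := hym.exists_isFirstSpecial
  rw [hu hex.choose_spec hs, hu hey.choose_spec ht] at h1
  have hsM := lt_of_forall_not_occurs hM hx hs'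
  have htM := lt_of_forall_not_occurs hM hy ht'
  -- The common window cannot end later in either point, by `le_of_window_eq` used both ways.
  obtain rfl : s = t := le_antisymm
    (le_of_window_eq hn hym.1 ht.1 htM hs' h1.symm) (le_of_window_eq hn hxm.1 hs.1 hsM ht' h1)
  refine ⟨s, hs, ht, hsM, fun i hi1 hi2 => ?_⟩
  have := window_eq_window_iff.1 h1 (i - s) (by omega) (by omega)
  simpa using this

include hM hD in
/-- Marked points with the same code continue the right special words that they both meet
before the next occurrence with the same letter. -/
theorem apply_eq_of_code_eq {x y : ℤ → A} (hx : x ∈ X.carrier) (hy : y ∈ X.carrier)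
    (h : X.code u L n x = X.code u L n y) {t : ℤ} (ht : window n x t ∈ X.rightSpecial n)
    (hw : window n x t = window n y t) (hL : L ≤ t)
    (hx0 : ∀ d, 0 < d → d ≤ t - L → ¬ Occurs u L x d)
    (hy0 : ∀ d, 0 < d → d ≤ t - L → ¬ Occurs u L y d) : x t = y t := by
  have key : ∀ z ∈ X.carrier, window n z t = window n x t →
      (∀ d, 0 < d → d ≤ t - L → ¬ Occurs u L z d) →
      (X.code u L n z).2 ⟨window n x t, ht⟩ = z t := by
    intro z hz hzw hz0
    have hex : ∃ t' : ℤ, L ≤ t' ∧ (∀ d, 0 < d → d ≤ t' - L → ¬ Occurs u L z d) ∧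
        window n z t' = window n x t := ⟨t, hL, hz0, hzw⟩
    simp only [code, dif_pos hex]
    obtain ⟨h1, h2, h3⟩ := hex.choose_spec
    have h4 := lt_of_forall_not_occurs hM hz h2
    have h5 := lt_of_forall_not_occurs hM hz hz0
    -- The position picked by choice in `code` is the actual one: both lie in a stretch of length
    -- `M`, where a window occurs only once.
    rw [eq_of_window_eq_of_near hD hz (by omega) (by omega) (h3.trans hzw.symm)]
  rw [← key x hx rfl hx0, ← key y hy hw.symm hy0, h]

include hM in
theorem isClopen_isMark [DiscreteTopology A] :
    IsClopen {x : X.carrier | X.IsMark u L n x.1 0} := by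
  -- The witness `t` ends before `M + L`, so a mark at 0 is visible in a bounded window.
  refine isClopen_of_agree (n + M + L) fun x y hxy hx => ?_
  obtain ⟨ho, t, h1, h2, h3⟩ := hx
  have ht := lt_of_forall_not_occurs hM x.2 h3
  refine ⟨ho.congr' fun i hi1 hi2 => hxy i (by push_cast; omega) (by push_cast; omega),
    t, h1, ?_, fun d hd hdt hod => h3 d hd hdt ?_⟩
  · rwa [← window_congr fun i hi1 hi2 => hxy i (by push_cast; omega) (by push_cast; omega)]
  · exact hod.congr' fun i hi1 hi2 =>
      (hxy i (by push_cast; omega) (by push_cast; omega)).symm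

/-- If the difference of the complexity function is at most `K` infinitely often, then every
cylinder contains a nonempty clopen set whose points have few words of first return. -/
theorem exists_isClopen_code [DiscreteTopology A] [Finite A]
    (hmin : IsMinimalHomeo X.shiftHomeo) (hinf : X.carrier.Infinite) {K : ℕ}
    (hK : ∃ᶠ n in atTop, X.complexity (n + 1) - X.complexity n ≤ K) (z : X.carrier) (L : ℕ) :
    ∃ B : Set X.carrier, IsClopen B ∧ B.Nonempty ∧ (∀ x ∈ B, Agree L x.1 z.1) ∧
      ∃ (C : Type u) (_ : Finite C) (f : X.carrier → C),
        Nat.card C ≤ (K + 1) * Nat.card A ^ K ∧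
        ∀ x ∈ B, ∀ y ∈ B, f x = f y → ∀ r, IsReturnTime X.shiftHomeo B x r →
          IsReturnTime X.shiftHomeo B y r ∧ ∀ i : ℤ, 0 ≤ i → i < r → x.1 i = y.1 i := by
  obtain ⟨M, hM'⟩ := hmin.exists_zpow_mem (isClopen_agree L z.1).isOpen ⟨z, fun _ _ _ => rfl⟩
  have hM : ∀ x ∈ X.carrier, ∀ t : ℤ, ∃ e, t < e ∧ e ≤ t + M ∧ Occurs z.1 L x e := by
    intro x hx t
    obtain ⟨y, hy⟩ := exists_shift t hx
    obtain ⟨k, hk0, hkM, hk⟩ := hM' y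
    refine ⟨t + k, by omega, by omega, fun i h1 h2 => ?_⟩
    rw [← hk i h1 h2, shiftHomeo_zpow_apply, hy]
    exact congrArg x (by ring)
  obtain ⟨D, hD'⟩ := exists_bound_of_period hmin hinf M
  -- `M + 2 * L` lets the first right special word reach back over the central word at the mark; `D`
  -- rules out repetitions within distance `M`.
  obtain ⟨n, hn', hnK⟩ := Filter.frequently_atTop.1 hK (M + 2 * L + D)
  have hn : M + 2 * L ≤ n := by omega
  have hD : ∀ p : ℕ, 0 < p → p ≤ M → ∀ x ∈ X.carrier, ∀ t : ℤ,
      ∃ i, t ≤ i ∧ i < t + n ∧ x i ≠ x (i + p) := by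
    intro p hp hpM x hx t
    obtain ⟨i, h1, h2, h3⟩ := hD' p hp hpM x hx t
    exact ⟨i, h1, by omega, h3⟩
  have hcard : (X.rightSpecial n).ncard ≤ K := (X.ncard_rightSpecial_le n).trans hnK
  have : Nonempty A := ⟨z.1 0⟩
  have hiter : ∀ (x : X.carrier) (j : ℕ), X.shiftHomeo^[j] x ∈
      {x : X.carrier | X.IsMark z.1 L n x.1 0} ↔ X.IsMark z.1 L n x.1 j := by
    intro x j
    have := isMark_shift_iff (X := X) (u := z.1) (L := L) (n := n)
      (shiftHomeo_iterate_apply j x) (e := 0)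
    rwa [zero_add] at this
  refine ⟨{x : X.carrier | X.IsMark z.1 L n x.1 0}, isClopen_isMark hM, ?_, ?_, _, inferInstance,
    fun x => X.code z.1 L n x.1, ?_, ?_⟩
  · obtain ⟨w, hw⟩ := rightSpecial_nonempty hmin hinf n
    obtain ⟨x, hx, -, -, t, -, h1, -, -⟩ := id hw
    subst h1
    obtain ⟨e, he1, he2, he3⟩ := hM x hx (t - L - M)
    obtain ⟨d, -, hd, -⟩ := exists_isMark (u := z.1) hw ⟨e, by omega, he3⟩
    obtain ⟨y, hy⟩ := exists_shift d hx
    refine ⟨y, (isMark_shift_iff hy).2 ?_⟩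
    rwa [zero_add]
  · intro x hx i h1 h2
    have := hx.1 i h1 h2
    rwa [zero_add] at this
  · rw [nat_card_code]
    exact Nat.mul_le_mul (by omega) (Nat.pow_le_pow_right Nat.card_pos hcard)
  · rintro x hx y hy hxy r ⟨hr0, hr, hrmin⟩
    obtain ⟨t₀, hx₀, hy₀, htM, hw⟩ := exists_isFirstSpecial_of_code_eq hM hn x.2 y.2 hx hy hxy
    obtain ⟨h1, h2, h3⟩ := isMark_next_of_agree (r := r) x.2 y.2 hx₀ hy₀ hw (by omega)
      (fun t => apply_eq_of_code_eq hM hD x.2 y.2 hxy) (by omega) ((hiter x r).1 hr)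
      (fun j hj0 hjr hj => hrmin j.toNat (by omega) (by omega)
        ((hiter x _).2 (by rwa [Int.toNat_of_nonneg hj0.le])))
    exact ⟨⟨hr0, (hiter y r).2 h1, fun j hj0 hjr hj =>
      h2 j (by omega) (by omega) ((hiter y j).1 hj)⟩, h3⟩

end Marks

end SymbolicDynamics.FullShift.Subshift

namespace SymbolicDynamics.FullShift.Subshift

/-! ### Nested partitions with few towers -/

section Partitions

variable {A : Type*} [TopologicalSpace A] [DiscreteTopology A] [Finite A] {X : Subshift A ℤ}

theorem exists_krPartition (hmin : IsMinimalHomeo X.shiftHomeo) (hinf : X.carrier.Infinite) {K : ℕ}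
    (hK : ∃ᶠ n in atTop, X.complexity (n + 1) - X.complexity n ≤ K) (z : X.carrier) (L : ℕ) :
    ∃ P : KRPartition X.shiftHomeo, Nat.card P.ι ≤ (K + 1) * Nat.card A ^ K ∧
      (∀ x, P.lvl x = 0 → Agree L x.1 z.1) ∧
      ∀ x y, P.vtx x = P.vtx y → P.lvl x = P.lvl y → Agree L x.1 y.1 := by
  classical
  obtain ⟨B, hB, hne, hBz, C, _, f, hC, hf⟩ := exists_isClopen_code hmin hinf hK z L
  have hvisit := hmin.exists_symm_iterate_mem hB.isOpen hne
  choose r hr using hmin.exists_isReturnTime hB.isOpen hne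
  -- Towers are indexed by return words rather than by codes, so that none is empty; distinct words
  -- have distinct codes, which keeps the count.
  let w : X.carrier → List A := fun x => (List.range (r x)).map fun i : ℕ => x.1 i
  have hwlen : ∀ x, (w x).length = r x := fun x => by simp [w]
  have hw : ∀ x y, w x = w y ↔ r x = r y ∧ ∀ i : ℕ, i < r x → x.1 i = y.1 i := by
    intro x y
    constructor
    · intro h
      have hxy : r x = r y := by rw [← hwlen, ← hwlen, h]
      refine ⟨hxy, fun i hi => ?_⟩
      simp only [w, ← hxy] at h
      exact List.map_inj_left.1 h i (List.mem_range.2 hi)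
    · rintro ⟨h1, h2⟩
      simp only [w, ← h1]
      exact List.map_inj_left.2 fun i hi => h2 i (List.mem_range.1 hi)
  have hwf : ∀ x ∈ B, ∀ y ∈ B, f x = f y → w x = w y := by
    intro x hx y hy hxy
    obtain ⟨h1, h2⟩ := hf x hx y hy hxy (r x) (hr x)
    exact (hw x y).2 ⟨h1.eq (hr y), fun i hi => h2 i (by omega) (by omega)⟩
  let g : w '' B → C := fun v => f v.2.choose
  have hg : Function.Injective g := by
    intro v v' h
    obtain ⟨h1, h2⟩ := v.2.choose_spec
    obtain ⟨h3, h4⟩ := v'.2.choose_spec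
    exact Subtype.ext (by rw [← h2, ← h4]; exact hwf _ h1 _ h3 h)
  have : Finite (w '' B) := Finite.of_injective g hg
  let e := Finite.equivFin (w '' B)
  obtain ⟨b, hb⟩ := hne
  let label : X.carrier → Fin (Nat.card (w '' B)) := fun x =>
    if hx : x ∈ B then e ⟨w x, x, hx, rfl⟩ else e ⟨w b, b, hb, rfl⟩
  have hlabel : ∀ x ∈ B, e.symm (label x) = w x := by
    intro x hx
    simp only [label, dif_pos hx, Equiv.symm_apply_apply]
  have hlabel' : ∀ x ∈ B, ∀ y ∈ B, label x = label y ↔ w x = w y := by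
    intro x hx y hy
    rw [← hlabel x hx, ← hlabel y hy, Subtype.coe_inj, e.symm.apply_eq_iff_eq]
  have hloc : ∀ x ∈ B, ∀ᶠ y in nhds x, label y = label x := by
    intro x hx
    have hag := (isClopen_agree (X := X) (r x) x.1).isOpen.mem_nhds fun _ _ _ => rfl
    filter_upwards [hB.isOpen.mem_nhds hx, (hr x).eventually hB, hag] with y hyB hyr hy
    refine (hlabel' y hyB x hx).2 ((hw y x).2 ?_)
    have hxy : r y = r x := (hr y).eq hyr
    exact ⟨hxy, fun i hi => hy i (by omega) (by omega)⟩
  let P : KRPartition X.shiftHomeo := KRPartition.ofBase hB hvisit _ label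
    (fun v => (e.symm v).1.length) hloc
    (fun x hx => by rw [hlabel x hx, hwlen]; exact hr x) (fun v => by
      obtain ⟨x, hx, hxv⟩ := (e.symm v).2
      refine ⟨x, hx, ?_⟩
      rw [← e.symm.apply_eq_iff_eq]
      exact Subtype.ext ((hlabel x hx).trans hxv))
  refine ⟨P, ?_, ?_, ?_⟩
  · change Nat.card (Fin _) ≤ _
    rw [Nat.card_fin]
    exact (Nat.card_le_card_of_injective g hg).trans hC
  · exact fun x hx => hBz x ((KRPartition.age_eq_zero_iff hvisit).1 hx)
  · intro x y hv hl i hi1 hi2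
    have hx' := KRPartition.lastVisit_mem hvisit x
    have hy' := KRPartition.lastVisit_mem hvisit y
    have hxa := KRPartition.iterate_age_lastVisit hvisit x
    have hya := KRPartition.iterate_age_lastVisit hvisit y
    have hlt := KRPartition.age_lt hvisit (hr (KRPartition.lastVisit hvisit x))
    rw [show KRPartition.age hvisit y = KRPartition.age hvisit x from hl.symm] at hya
    obtain ⟨h1, h2⟩ := (hw _ _).1 ((hlabel' _ hx' _ hy').1 hv)
    have h3 := (hr (KRPartition.lastVisit hvisit x)).2.1
    have h4 := (hr (KRPartition.lastVisit hvisit y)).2.1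
    rw [← h1] at h4
    generalize KRPartition.lastVisit hvisit x = x' at *
    generalize KRPartition.lastVisit hvisit y = y' at *
    generalize KRPartition.age hvisit x = k at *
    rw [← hxa, ← hya, shiftHomeo_iterate_apply, shiftHomeo_iterate_apply]
    -- Coordinates before the tower or beyond its top are given by the central word at the last
    -- visit or at the next return; those between are given by the return word.
    rcases lt_or_ge (i + k) 0 with h5 | h5
    · rw [hBz x' hx' _ (by omega) (by omega), hBz y' hy' _ (by omega) (by omega)]
    rcases lt_or_ge (i + k) (r x') with h6 | h6
    · have := h2 (i + k).toNat (by omega)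
      rwa [Int.toNat_of_nonneg h5] at this
    · have h7 := hBz _ h3 (i + k - r x') (by omega) (by omega)
      have h8 := hBz _ h4 (i + k - r x') (by omega) (by omega)
      rw [shiftHomeo_iterate_apply, sub_add_cancel] at h7 h8
      rw [h7, h8]

theorem exists_refines (hmin : IsMinimalHomeo X.shiftHomeo) (hinf : X.carrier.Infinite) {K : ℕ}
    (hK : ∃ᶠ n in atTop, X.complexity (n + 1) - X.complexity n ≤ K)
    (P : KRPartition X.shiftHomeo) (n : ℕ) :
    ∃ Q : KRPartition X.shiftHomeo, Q.Refines P ∧ Nat.card Q.ι ≤ (K + 1) * Nat.card A ^ K ∧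
      (∀ x y, Q.lvl x = 0 → Q.lvl y = 0 → Agree n x.1 y.1) ∧
      (∀ x y, Q.vtx x = Q.vtx y → Q.lvl x = Q.lvl y → Agree n x.1 y.1) ∧
      ∀ v, n < Q.height v := by
  obtain ⟨x₀, hx₀⟩ := hinf.nonempty
  obtain ⟨z, -, hz⟩ := P.exists_base (P.vtx ⟨x₀, hx₀⟩)
  obtain ⟨L₁, hL₁⟩ := P.vtx_loc.exists_agree
  obtain ⟨L₂, hL₂⟩ := P.lvl_loc.exists_agree
  obtain ⟨D, hD⟩ := exists_bound_of_period hmin hinf n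
  -- `z` is in the base of `P`, so radius `L₂` puts the new base inside it; `L₁` and `L₂` together
  -- make the atoms refine those of `P`, `D` makes the towers tall, and `n` separates points.
  obtain ⟨Q, hcard, hbase, hatom⟩ := exists_krPartition hmin hinf hK z (L₁ + L₂ + D + n)
  refine ⟨Q, ⟨fun x y h1 h2 => ?_, fun x hx => ?_⟩, hcard, fun x y hx hy i hi1 hi2 => ?_,
    fun x y hv hl i hi1 hi2 => ?_, fun v => ?_⟩
  · have := hatom x y h1 h2
    exact ⟨hL₁ _ (by omega) x y this, hL₂ _ (by omega) x y this⟩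
  · rw [← hz]
    exact hL₂ _ (by omega) x z (hbase x hx)
  · rw [hbase x hx i (by omega) (by omega), hbase y hy i (by omega) (by omega)]
  · exact hatom x y hv hl i (by omega) (by omega)
  · by_contra! hle
    obtain ⟨x, rfl, hx⟩ := Q.exists_base v
    have hpos := Q.lvl_lt x
    have h1 := KRPartition.iterate_of_lt (P := Q) (x := x) (k := Q.height (Q.vtx x) - 1) (by omega)
    have h2 := Q.map_of_top _ (by rw [h1.1, h1.2]; omega)
    rw [← Function.iterate_succ_apply' (f := X.shiftHomeo)] at h2
    -- A short tower would return from base to base in at most `n` steps, giving a word of length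
    -- `D` with period at most `n`.
    obtain ⟨i, hi1, hi2, hi3⟩ := hD (Q.height (Q.vtx x)) (by omega) hle x.1 x.2 0
    have h3 := hbase _ h2 i (by omega) (by omega)
    rw [shiftHomeo_iterate_apply] at h3
    refine hi3 ((hbase x hx i (by omega) (by omega)).trans (h3.symm.trans ?_))
    exact congrArg x.1 (by omega)

/-- If the difference of the complexity function is at most `K` infinitely often, then the
topological rank is at most `(K + 1) |A| ^ K`. -/
theorem topologicalRank_le (hmin : IsMinimalHomeo X.shiftHomeo) (hinf : X.carrier.Infinite) {K : ℕ}
    (hK : ∃ᶠ n in atTop, X.complexity (n + 1) - X.complexity n ≤ K) :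
    topologicalRank X.shiftHomeo ≤ ((K + 1) * Nat.card A ^ K : ℕ) := by
  have : Nonempty X.carrier := hinf.nonempty.to_subtype
  have : Nonempty A := ⟨(Classical.arbitrary X.carrier).1 0⟩
  choose next hnext using exists_refines hmin hinf hK
  let P : ℕ → KRPartition X.shiftHomeo := fun n =>
    Nat.rec (KRPartition.trivial X.shiftHomeo) (fun n Q => next Q n) n
  have href : ∀ n, (P (n + 1)).Refines (P n) := fun n => (hnext (P n) n).1
  have h0 : Nat.card (P 0).ι = 1 := Nat.card_unique (α := Unit)
  have hone : 1 ≤ (K + 1) * Nat.card A ^ K :=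
    Nat.mul_pos (Nat.succ_pos K) (Nat.pow_pos Nat.card_pos)
  refine iInf₂_le _ ⟨KRPartition.diagram P href h0, ?_, fun n => ?_⟩
  · refine KRPartition.isBratteliVershikRep_diagram href h0 (fun _ => rfl) ?_ ?_ ?_
    · intro x y h
      refine Subtype.ext (funext fun i => ?_)
      -- The partition `P (j + 1)` is built with radius `j`, and `j = i.natAbs + 1` makes `[-j, j)`
      -- contain `i`.
      obtain ⟨h1, h2⟩ := h (i.natAbs + 1 + 1)
      exact (hnext (P (i.natAbs + 1)) _).2.2.2.1 x y h1 h2 i (by omega) (by omega)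
    · have hC : ∀ n, IsClosed {x | (P n).lvl x = 0} := fun n => (P n).lvl_loc.isClosed_fiber 0
      obtain ⟨z, hz⟩ := IsCompact.nonempty_iInter_of_sequence_nonempty_isCompact_isClosed
        (fun n => {x | (P n).lvl x = 0}) (fun n x hx => (href n).base x hx)
        (fun n => by
          obtain ⟨x, -, hx⟩ := (P n).exists_base ((P n).vtx (Classical.arbitrary _))
          exact ⟨x, hx⟩) (hC 0).isCompact hC
      have hz' : ∀ n, (P n).lvl z = 0 := fun n => mem_iInter.1 hz n
      refine ⟨z, hz', fun y hy => Subtype.ext (funext fun i => ?_)⟩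
      exact (hnext (P (i.natAbs + 1)) _).2.2.1 y z (hy (i.natAbs + 1 + 1)) (hz' (i.natAbs + 1 + 1))
        i (by omega) (by omega)
    · intro n _
      have hu : ∀ u : (P n).ι, ∃ M : ℕ, ∀ x, ∃ k : ℕ, 0 < k ∧ k ≤ M ∧
          X.shiftHomeo^[k] x ∈ {x | (P n).vtx x = u} := fun u =>
        hmin.exists_iterate_mem ((P n).vtx_loc.isOpen_fiber u) ((P n).vtx_surjective u)
      choose M hM using hu
      obtain ⟨m, hm⟩ : ∃ m, ∀ u, M u ≤ m := by
        obtain ⟨m, hm⟩ := (Set.finite_range M).bddAbove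
        exact ⟨m, fun u => hm ⟨u, rfl⟩⟩
      -- Towers at this level are taller than the time `m` within which every orbit visits every
      -- tower of `P n`.
      refine ⟨n + m + 1, by omega, fun u v => ?_⟩
      obtain ⟨x, rfl, hx⟩ := (P (n + m + 1)).exists_base v
      obtain ⟨k, -, hk, hku⟩ := hM u x
      have hh : n + m < (P (n + m + 1)).height ((P (n + m + 1)).vtx x) :=
        (hnext (P (n + m)) (n + m)).2.2.2.2 ((P (n + m + 1)).vtx x)
      have := hm u
      exact ⟨X.shiftHomeo^[k] x, hku, (KRPartition.iterate_of_lt (by omega)).1⟩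
  · cases n with
    | zero => exact h0.le.trans hone
    | succ n => exact (hnext (P n) n).2.1

/-! ### From lower limits to bounded differences along a subsequence -/

omit [DiscreteTopology A] [Finite A] in
theorem frequently_complexity_sub_le {K : ℕ}
    (h : liminf (fun n : ℕ => ((X.complexity (n + 1) - X.complexity n : ℕ) : ℕ∞)) atTop = K) :
    ∃ᶠ n in atTop, X.complexity (n + 1) - X.complexity n ≤ K := by
  have hlt : liminf (fun n : ℕ => ((X.complexity (n + 1) - X.complexity n : ℕ) : ℕ∞)) atTop <
      ((K + 1 : ℕ) : ℕ∞) := by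
    rw [h]
    exact_mod_cast Nat.lt_succ_self K
  refine (Filter.frequently_lt_of_liminf_lt (by isBoundedDefault) hlt).mono fun n hn => ?_
  have : X.complexity (n + 1) - X.complexity n < K + 1 := by exact_mod_cast hn
  omega

omit [DiscreteTopology A] [Finite A] in
theorem exists_frequently_complexity_sub_le
    (h : liminf (fun n : ℕ => (X.complexity n : ℝ≥0∞) / (n : ℝ≥0∞)) atTop < ⊤) :
    ∃ K : ℕ, ∃ᶠ n in atTop, X.complexity (n + 1) - X.complexity n ≤ K := by
  obtain ⟨C, hC⟩ := ENNReal.exists_nat_gt h.ne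
  have hfreq := Filter.frequently_lt_of_liminf_lt (by isBoundedDefault) hC
  refine ⟨C, fun hcon => ?_⟩
  obtain ⟨N, hN⟩ := Filter.eventually_atTop.1 hcon
  -- If the differences were eventually at least `C + 1`, the growth would contradict `p(n) < C n`
  -- at some `n > (C + 1) N`.
  have hgrow : ∀ k, (C + 1) * k ≤ X.complexity (N + k) := by
    intro k
    induction k with
    | zero => simp
    | succ k ih =>
      have := hN (N + k) (by omega)
      rw [mul_add, mul_one, ← add_assoc N]
      omega
  obtain ⟨n, hn, hlt⟩ := Filter.frequently_atTop.1 hfreq ((C + 1) * N + 1)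
  have hNn : N ≤ n := by nlinarith
  obtain ⟨k, rfl⟩ := Nat.exists_eq_add_of_le hNn
  have h1 : X.complexity (N + k) < C * (N + k) := by
    rw [ENNReal.div_lt_iff (Or.inl (by simp; omega)) (Or.inl (by simp))] at hlt
    exact_mod_cast hlt
  have := hgrow k
  nlinarith

end Partitions

end SymbolicDynamics.FullShift.Subshift

theorem mainTheorem3 {A : Type*} [Fintype A] [TopologicalSpace A] [DiscreteTopology A]
    (X : SymbolicDynamics.FullShift.Subshift A ℤ) (hmin : IsMinimalHomeo X.shiftHomeo) :
    (X.carrier.Infinite → ∀ K₁ : ℕ,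
      liminf (fun n : ℕ => ((X.complexity (n + 1) - X.complexity n : ℕ) : ℕ∞)) atTop = K₁ →
      topologicalRank X.shiftHomeo
        ≤ (((1 + Fintype.card A ^ 2 * K₁ ^ 2) ^ (2 * (K₁ + 2)) : ℕ) : ℕ∞)) ∧
    (X.carrier.Nonempty →
      liminf (fun n : ℕ => (X.complexity n : ℝ≥0∞) / (n : ℝ≥0∞)) atTop < ⊤ →
      topologicalRank X.shiftHomeo < ⊤) := by
  refine ⟨fun hinf K hK => ?_, fun hne h => ?_⟩
  · refine (X.topologicalRank_le hmin hinf (X.frequently_complexity_sub_le hK)).trans ?_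
    rw [Nat.card_eq_fintype_card, Nat.cast_le]
    have hA : 0 < Fintype.card A := by
      obtain ⟨x, -⟩ := hinf.nonempty
      exact Fintype.card_pos_iff.2 ⟨x 0⟩
    set a := Fintype.card A
    rcases Nat.eq_zero_or_pos K with rfl | hKpos
    -- For `K = 0` both bounds are 1; the comparison `h2` below needs `K` positive.
    · simp
    have h1 : K + 1 ≤ 1 + a ^ 2 * K ^ 2 := by
      have := Nat.mul_le_mul (Nat.one_le_iff_ne_zero.2 (pow_pos hA 2).ne')
        (Nat.le_self_pow two_ne_zero K)
      omega
    have h2 : a ≤ 1 + a ^ 2 * K ^ 2 := by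
      have := Nat.mul_le_mul (Nat.le_self_pow two_ne_zero a)
        (Nat.one_le_iff_ne_zero.2 (pow_pos hKpos 2).ne')
      omega
    calc (K + 1) * a ^ K ≤ (1 + a ^ 2 * K ^ 2) * (1 + a ^ 2 * K ^ 2) ^ K :=
          Nat.mul_le_mul h1 (Nat.pow_le_pow_left h2 K)
      _ = (1 + a ^ 2 * K ^ 2) ^ (K + 1) := (pow_succ' _ K).symm
      _ ≤ _ := Nat.pow_le_pow_right (by omega) (by omega)
  · rcases X.carrier.finite_or_infinite with hfin | hinf
    · have := hfin.to_subtype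
      have := hne.to_subtype
      exact hmin.topologicalRank_le_one.trans_lt (by exact_mod_cast ENat.natCast_lt_top 1)
    · obtain ⟨K, hK⟩ := X.exists_frequently_complexity_sub_le h
      exact (X.topologicalRank_le hmin hinf hK).trans_lt (ENat.natCast_lt_top _)
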